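/- Let $\mathfrak F=\langle F,+,\cdot,0,1,\le\rangle$ be an arbitrary ordered field and let $d\ge 2$. Write points of $F^d$ as $p=\langle p_1,\dots,p_d\rangle$, where $p_1$ is the time coordinate. For $p,q\in F^d$ put $$\mathsf d^2(p,q)=(p_1-q_1)^2+(p_2-q_2)^2+\dots+(p_d-q_d)^2,\qquad \mathsf d^2_\mu(p,q)=(p_1-q_1)^2-(p_2-q_2)^2-\dots-(p_d-q_d)^2 .$$ Consider the following relations on $F^d$: - betweenness: $\mathsf{Bw}(p,q,r)$ iff $q=p+t(r-p)$ for some $t\in F$ with $0\le t\le 1$; - simultaneity: $p\,\mathsf S\,q$ iff $p_1=q_1$; - being at rest: $p\,\mathsf{Rest}\,q$ iff $(p_2,\dots,p_d)=(q_2,\dots,q_d)$; - lightlike relatedness: $p\,\lambda\,q$ iff $(p_1-q_1)^2=(p_2-q_2)^2+\dots+(p_d-q_d)^2$; - congruence: $(p,q)\equiv(r,s)$ iff $\mathsf d^2(p,q)=\mathsf d^2(r,s)$; - Minkowski congruence: $(p,q)\equiv_\mu(r,s)$ iff $\mathsf d^2_\mu(p,q)=\mathsf d^2_\mu(r,s)$;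 - congruence on simultaneity: $(p,q)\equiv_{\mathsf S}(r,s)$ iff $(p,q)\equiv(r,s)$, $p\,\mathsf S\,q$ and $r\,\mathsf S\,s$; - $\delta(p,q,r)$ iff $p\,\mathsf S\,q$ and $p\,\lambda\,r$. Define the first-order relational models $\mathrm{OAff}=\langle F^d,\mathsf{Bw}\rangle$, $\mathrm{Eucl}=\langle F^d,\equiv,\mathsf{Bw}\rangle$, $\mathrm{Rel}=\langle F^d,\lambda,\mathsf{Bw}\rangle$, $\mathrm{Mink}=\langle F^d,\equiv_\mu,\mathsf{Bw}\rangle$, $\mathrm{Gal}=\langle F^d,\equiv_{\mathsf S},\mathsf{Bw}\rangle$, $\mathrm{Newt}=\langle F^d,\equiv_{\mathsf S},\mathsf{Bw},\mathsf{Rest}\rangle$, $\mathrm{LClass}=\langle F^d,\equiv_{\mathsf S},\mathsf{Bw},\lambda\rangle$. For a model $\mathcal G$ let $\mathrm{Ca}(\mathcal G)$, the set of concepts of $\mathcal G$, be the set of all finitary relations on its universe that are definable in $\mathcal G$ by a first-order formula without parameters. Two models with the same universe are definitionally equivalent if they have the same concepts. Then: (i) $\mathrm{Ca}(\mathrm{Rel})=\mathrm{Ca}(\mathrm{Mink})$,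 i.e. $\mathrm{Rel}$ and $\mathrm{Mink}$ are definitionally equivalent. (ii) $\mathrm{Ca}(\mathrm{Gal})\subseteq\mathrm{Ca}(\mathrm{Newt})$. (iii) $\mathrm{Ca}(\mathrm{OAff})\subseteq\mathrm{Ca}(\mathrm{Eucl})\cap\mathrm{Ca}(\mathrm{Rel})\cap\mathrm{Ca}(\mathrm{Gal})$. (iv) $\mathrm{Ca}(\mathrm{Eucl})\cup\mathrm{Ca}(\mathrm{Rel})\cup\mathrm{Ca}(\mathrm{Newt})\subseteq\mathrm{Ca}(\mathrm{LClass})$. (v) Membership of the relations in the concept-sets is exactly as follows: $$\begin{array}{c|ccccc} & \mathrm{Ca}(\mathrm{Eucl}) & \mathrm{Ca}(\mathrm{Rel}) & \mathrm{Ca}(\mathrm{Gal}) & \mathrm{Ca}(\mathrm{Newt}) & \mathrm{Ca}(\mathrm{LClass})\\\hline \equiv & \in & \notin & \notin & \notin & \in\\ \equiv_\mu & \notin & \in & \notin & \notin & \in\\ \lambda & \notin & \in & \notin & \notin & \in\\ \equiv_{\mathsf S} & \notin & \notin & \in & \in & \in\\ \mathsf S & \notin & \notin & \in & \in & \in\\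 \mathsf{Rest} & \notin & \notin & \notin & \in & \in\\ \delta & \notin & \notin & \notin & \notin & \in \end{array}$$ Moreover $\mathsf{Bw}\in\mathrm{Ca}(\mathrm{OAff})$, while none of the seven relations in the table belongs to $\mathrm{Ca}(\mathrm{OAff})$. (vi) All the inclusions are proper: $\mathrm{Ca}(\mathrm{OAff})$ is a proper subset of each of $\mathrm{Ca}(\mathrm{Eucl})$, $\mathrm{Ca}(\mathrm{Rel})$ and $\mathrm{Ca}(\mathrm{Gal})$; $\mathrm{Ca}(\mathrm{Gal})\subsetneq\mathrm{Ca}(\mathrm{Newt})$; and each of $\mathrm{Ca}(\mathrm{Eucl})$, $\mathrm{Ca}(\mathrm{Rel})$ and $\mathrm{Ca}(\mathrm{Newt})$ is a proper subset of $\mathrm{Ca}(\mathrm{LClass})$. There are no further inclusions: $\mathrm{Ca}(\mathrm{Eucl})$ and $\mathrm{Ca}(\mathrm{Rel})$ are incomparable under $\subseteq$, and each of them is incomparable with both $\mathrm{Ca}(\mathrm{Gal})$ and $\mathrm{Ca}(\mathrm{Newt})$. -/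

import Mathlib

namespace UnitFreeGeometry

/-! ### Relational models and their concepts -/

/-- A finitary relation on `M`: an arity `n` together with a subset of `Mⁿ`. -/
abbrev FinRel (M : Type*) := Σ n : ℕ, Set (Fin n → M)

/-- A relational model (no functions, no constants) with universe `M` is given by the set of its
basic relations. `relLanguage B` is the first-order language with one `n`-ary relation symbol for
each `n`-ary relation in `B`, and no other symbols. -/
def relLanguage {M : Type*} (B : Set (FinRel M)) : FirstOrder.Language where
  Functions _ := Empty
  Relations n := {R : Set (Fin n → M) // (⟨n, R⟩ : FinRel M) ∈ B}

/-- The model `⟨M, B⟩`: every relation symbol is interpreted as the relation it names. -/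
instance relStructure {M : Type*} (B : Set (FinRel M)) : (relLanguage B).Structure M where
  funMap f := f.elim
  RelMap R x := x ∈ R.1

/-- The set of concepts of the model `⟨M, B⟩`: all finitary relations on `M` that are definable
in it, without parameters, by a first-order formula. -/
def concepts {M : Type*} (B : Set (FinRel M)) : Set (FinRel M) :=
  {R | (∅ : Set M).Definable (relLanguage B) R.2}

/-- Two models with the same universe are definitionally equivalent iff they have the same
concepts. -/
def DefinitionallyEquivalent {M : Type*} (B C : Set (FinRel M)) : Prop :=
  concepts B = concepts C

/-! ### Products and squared distances on `F^d`

Points of `F^d` are functions `Fin d → F`; the coordinate `0` is the time coordinate. -/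

section Products

variable {F : Type*} [Field F] {d : ℕ}

/-- The Euclidean scalar product `p₁q₁ + ⋯ + p_d q_d`. -/
def scalarProd (p q : Fin d → F) : F := ∑ i, p i * q i

/-- The Minkowski product `p₁q₁ - p₂q₂ - ⋯ - p_d q_d`. -/
def minkProd [NeZero d] (p q : Fin d → F) : F :=
  p 0 * q 0 - ∑ i ∈ Finset.univ.erase (0 : Fin d), p i * q i

/-- The squared Euclidean distance. -/
def sqEuclDist (p q : Fin d → F) : F := scalarProd (p - q) (p - q)

/-- The squared Minkowski distance. -/
def sqMinkDist [NeZero d] (p q : Fin d → F) : F := minkProd (p - q) (p - q)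

end Products

/-! ### The basic relations on `F^d` -/

section Relations

variable (F : Type*) [Field F] (d : ℕ)

/-- Betweenness: `Bw(p, q, r)` iff `q = p + t (r - p)` for some `t ∈ [0, 1]`. -/
def Bw [LinearOrder F] : FinRel (Fin d → F) :=
  ⟨3, {x | ∃ t : F, 0 ≤ t ∧ t ≤ 1 ∧ x 1 = x 0 + t • (x 2 - x 0)}⟩

/-- Euclidean congruence `(p, q) ≡ (r, s)`. -/
def Cng : FinRel (Fin d → F) :=
  ⟨4, {x | sqEuclDist (x 0) (x 1) = sqEuclDist (x 2) (x 3)}⟩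

variable [NeZero d]

/-- Absolute simultaneity: equality of the time coordinates. -/
def Simul : FinRel (Fin d → F) :=
  ⟨2, {x | x 0 0 = x 1 0}⟩

/-- Being at rest: equality of all the spatial coordinates. -/
def Rest : FinRel (Fin d → F) :=
  ⟨2, {x | ∀ i : Fin d, i ≠ 0 → x 0 i = x 1 i}⟩

/-- Lightlike relatedness: `(p₁ - q₁)² = (p₂ - q₂)² + ⋯ + (p_d - q_d)²`. -/
def Lightlike : FinRel (Fin d → F) :=
  ⟨2, {x | (x 0 0 - x 1 0) ^ 2 = ∑ i ∈ Finset.univ.erase (0 : Fin d), (x 0 i - x 1 i) ^ 2}⟩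

/-- Minkowski congruence `(p, q) ≡_μ (r, s)`. -/
def CngMink : FinRel (Fin d → F) :=
  ⟨4, {x | sqMinkDist (x 0) (x 1) = sqMinkDist (x 2) (x 3)}⟩

/-- Congruence on simultaneity: `(p, q) ≡_S (r, s)` iff `(p, q) ≡ (r, s)`, `p S q` and `r S s`. -/
def CngSimul : FinRel (Fin d → F) :=
  ⟨4, {x | sqEuclDist (x 0) (x 1) = sqEuclDist (x 2) (x 3) ∧ x 0 0 = x 1 0 ∧ x 2 0 = x 3 0}⟩

/-- The ternary relation `δ(p, q, r)`: `p S q` and `p λ r`. -/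
def Delta : FinRel (Fin d → F) :=
  ⟨3, {x | x 0 0 = x 1 0 ∧
    (x 0 0 - x 2 0) ^ 2 = ∑ i ∈ Finset.univ.erase (0 : Fin d), (x 0 i - x 2 i) ^ 2}⟩

end Relations

/-! ### The geometries, as sets of basic relations on `F^d` -/

section Geometries

variable (F : Type*) [Field F] [LinearOrder F] (d : ℕ)

/-- Ordered affine geometry `⟨F^d, Bw⟩`. -/
def OAff : Set (FinRel (Fin d → F)) := {Bw F d}

/-- Euclidean geometry `⟨F^d, ≡, Bw⟩`. -/
def Eucl : Set (FinRel (Fin d → F)) := {Cng F d, Bw F d}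

variable [NeZero d]

/-- Relativistic spacetime `⟨F^d, λ, Bw⟩`. -/
def Relativ : Set (FinRel (Fin d → F)) := {Lightlike F d, Bw F d}

/-- Minkowski spacetime `⟨F^d, ≡_μ, Bw⟩`. -/
def Mink : Set (FinRel (Fin d → F)) := {CngMink F d, Bw F d}

/-- Galilean spacetime `⟨F^d, ≡_S, Bw⟩`. -/
def Gal : Set (FinRel (Fin d → F)) := {CngSimul F d, Bw F d}

/-- Newtonian spacetime `⟨Gal, Rest⟩`. -/
def Newt : Set (FinRel (Fin d → F)) := insert (Rest F d) (Gal F d)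

/-- Late Classical spacetime `⟨Gal, λ⟩`. -/
def LClass : Set (FinRel (Fin d → F)) := insert (Lightlike F d) (Gal F d)

end Geometries

end UnitFreeGeometry

open UnitFreeGeometry

/-!
The inclusions between the sets of concepts reduce to single definability facts, because a model
whose basic relations are concepts of another one has no further concepts
(`concepts_subset_of_subset`); every failure of definability is witnessed by an automorphism
(`mem_iff_of_mem_concepts`).

Failures: in the plane of the time axis and one spatial axis, the rotation with cosine `3 / 5`
preserves Euclidean geometry, the boost with velocity `3 / 5` preserves relativistic spacetime,
a shear preserves Galilean spacetime and a change of the unit of time preserves Newtonian spacetime.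
All of them have rational entries, so they exist over every ordered field.

Definability: the two substantial facts are that lightlike relatedness and betweenness define
Minkowski congruence (`cngMink_mem_concepts`), and that late classical spacetime defines Euclidean
congruence (`cng_mem_concepts`). Square roots may be missing in `F`, so lengths cannot be transported
to a common line and compared there. Instead the equation between squared distances is evaluated in
coordinates. Affine geometry of dimension at least two defines parallelograms
(`parallelogram_iff`) and equality of ratios on two lines through a point (`sameRatio_iff`), hence
addition of vectors, multiplication of scalars coded on a line, and the sum of the signed squares of
the coordinates of a vector with respect to a frame (`frameSquare_iff`). A squared distance is this
sum times a factor that depends on the frame only, provided that the frame is orthogonal and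
its axes have equal squared lengths up to the signs of the form. Therefore congruence becomes
definable once a nonempty class of such frames is (`diagForm_congruence_mem_concepts`).

For the Minkowski form such frames are singled out by a few lightlike vectors: `e₀ ± eᵢ` being
lightlike makes `e₀` and `eᵢ` orthogonal of opposite squared lengths, and `5 e₀ + 3 eᵢ + 4 eⱼ` being
lightlike then makes `eᵢ` and `eⱼ` orthogonal (`LorentzFrame.minkForm_eq`). If in addition the axes
`eᵢ` are spatial and `e₀` is vertical, the frame is orthogonal and equilateral for the Euclidean form
as well. Being vertical, that is, the relation of rest, is definable because the light cone of a
point cuts any other simultaneity in a sphere around the projection of the point (`rest_iff`).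
-/

namespace UnitFreeGeometry

/-! ### Definable predicates -/

section DefinablePredicates

open FirstOrder FirstOrder.Language

variable {M : Type*} {B C : Set (FinRel M)} {α β : Type}

/-- A predicate on valuations `x : α → M` of variables from `α` is definable in `⟨M, B⟩` if some
first-order formula without parameters holds exactly at the valuations that satisfy it. -/
def DefinablePred (B : Set (FinRel M)) (P : (α → M) → Prop) : Prop :=
  ∃ φ : (relLanguage B).Formula α, ∀ x, φ.Realize x ↔ P x

theorem mem_concepts_iff {R : FinRel M} :
    R ∈ concepts B ↔ DefinablePred B fun x => x ∈ R.2 := by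
  change (∅ : Set M).Definable (relLanguage B) R.2 ↔ _
  rw [Set.empty_definable_iff]
  constructor
  · rintro ⟨φ, hφ⟩
    exact ⟨φ, fun x => by rw [hφ]; rfl⟩
  · rintro ⟨φ, hφ⟩
    exact ⟨φ, Set.ext fun x => (hφ x).symm⟩

namespace DefinablePred

theorem congr {P Q : (α → M) → Prop} (h : DefinablePred B P) (hPQ : ∀ x, Q x ↔ P x) :
    DefinablePred B Q := by
  obtain ⟨φ, hφ⟩ := h
  exact ⟨φ, fun x => (hφ x).trans (hPQ x).symm⟩

theorem and {P Q : (α → M) → Prop} (hP : DefinablePred B P) (hQ : DefinablePred B Q) :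
    DefinablePred B fun x => P x ∧ Q x := by
  obtain ⟨φ, hφ⟩ := hP
  obtain ⟨ψ, hψ⟩ := hQ
  exact ⟨φ ⊓ ψ, fun x => by rw [Formula.realize_inf, hφ, hψ]⟩

theorem not {P : (α → M) → Prop} (hP : DefinablePred B P) : DefinablePred B fun x => ¬ P x := by
  obtain ⟨φ, hφ⟩ := hP
  exact ⟨∼φ, fun x => by rw [Formula.realize_not, hφ]⟩

theorem or {P Q : (α → M) → Prop} (hP : DefinablePred B P) (hQ : DefinablePred B Q) :
    DefinablePred B fun x => P x ∨ Q x :=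
  (hP.not.and hQ.not).not.congr fun x => by tauto

theorem imp {P Q : (α → M) → Prop} (hP : DefinablePred B P) (hQ : DefinablePred B Q) :
    DefinablePred B fun x => P x → Q x :=
  (hP.not.or hQ).congr fun x => by tauto

theorem false : DefinablePred B fun _ : α → M => False :=
  ⟨⊥, fun _ => Iff.rfl⟩

theorem const (p : Prop) : DefinablePred B fun _ : α → M => p := by
  by_cases hp : p
  · exact false.not.congr fun _ => by simp [hp]
  · exact false.congr fun _ => by simp [hp]

theorem eq (i j : α) : DefinablePred B fun x : α → M => x i = x j :=
  ⟨(Term.var i).equal (Term.var j), fun x => by simp⟩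

theorem rel {R : FinRel M} (hR : R ∈ B) (v : Fin R.1 → α) :
    DefinablePred B fun x : α → M => (fun k => x (v k)) ∈ R.2 :=
  let r : (relLanguage B).Relations R.1 := ⟨R.2, hR⟩
  ⟨r.formula fun k => Term.var (v k), fun _ => Formula.realize_rel⟩

theorem reindex {P : (α → M) → Prop} (hP : DefinablePred B P) (g : α → β) :
    DefinablePred B fun x : β → M => P fun i => x (g i) := by
  obtain ⟨φ, hφ⟩ := hP
  exact ⟨φ.relabel g, fun x => by rw [Formula.realize_relabel, hφ]; rfl⟩

theorem concept {R : FinRel M} (hR : R ∈ concepts B) (v : Fin R.1 → α) :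
    DefinablePred B fun x : α → M => (fun k => x (v k)) ∈ R.2 :=
  (mem_concepts_iff.1 hR).reindex v

theorem exists_fun [Finite β] {P : (α → M) → (β → M) → Prop}
    (hP : DefinablePred B fun z : α ⊕ β → M => P (fun i => z (.inl i)) fun i => z (.inr i)) :
    DefinablePred B fun x => ∃ y : β → M, P x y := by
  obtain ⟨φ, hφ⟩ := hP
  refine ⟨φ.iExs β, fun x => ?_⟩
  rw [Formula.realize_iExs]
  exact exists_congr fun y => hφ _

theorem ex {P : (α → M) → M → Prop}
    (hP : DefinablePred B fun z : α ⊕ Unit → M => P (fun i => z (.inl i)) (z (.inr ()))) :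
    DefinablePred B fun x => ∃ y : M, P x y :=
  (exists_fun (P := fun x y => P x (y ())) hP).congr fun _ =>
    ⟨fun ⟨y, hy⟩ => ⟨fun _ => y, hy⟩, fun ⟨y, hy⟩ => ⟨y (), hy⟩⟩

theorem all {P : (α → M) → M → Prop}
    (hP : DefinablePred B fun z : α ⊕ Unit → M => P (fun i => z (.inl i)) (z (.inr ()))) :
    DefinablePred B fun x => ∀ y : M, P x y :=
  (ex (P := fun x y => ¬ P x y) hP.not).not.congr fun _ => by push Not; rfl

theorem forall_finite {ι : Type*} [Finite ι] {P : ι → (α → M) → Prop}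
    (hP : ∀ i, DefinablePred B (P i)) : DefinablePred B fun x => ∀ i, P i x := by
  choose φ hφ using hP
  exact ⟨Formula.iInf φ, fun x => by simp only [Formula.realize_iInf, hφ]⟩

/-- A formula over `⟨M, B⟩` becomes one over `⟨M, C⟩` when its relation symbols are replaced by
formulas that define them. -/
theorem of_subset_concepts (h : B ⊆ concepts C) {P : (α → M) → Prop} (hP : DefinablePred B P) :
    DefinablePred C P := by
  have key : ∀ {n : ℕ} (φ : (relLanguage B).BoundedFormula α n),
      DefinablePred C fun z : α ⊕ Fin n → M =>
        φ.Realize (fun i => z (.inl i)) fun i => z (.inr i) := by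
    -- the language has no function symbols, so every term is a variable
    have hterm : ∀ {γ : Type} (t : (relLanguage B).Term γ), ∃ i, t = Term.var i := by
      intro γ t
      cases t with
      | var i => exact ⟨i, rfl⟩
      | func f _ => exact f.elim
    intro n φ
    induction φ with
    | falsum => exact false
    | equal t₁ t₂ =>
      obtain ⟨i, rfl⟩ := hterm t₁
      obtain ⟨j, rfl⟩ := hterm t₂
      refine (eq i j).congr fun z => ?_
      simp only [BoundedFormula.Realize, Term.realize_var]
      cases i <;> cases j <;> rfl
    | rel R ts =>
      choose v hv using fun k => hterm (ts k)
      refine (concept (h R.2) v).congr fun z => ?_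
      simp only [BoundedFormula.Realize, hv, Term.realize_var]
      change (fun k => _) ∈ R.1 ↔ (fun k => _) ∈ R.1
      refine iff_of_eq (congrArg (· ∈ R.1) (funext fun k => ?_))
      cases v k <;> rfl
    | imp φ ψ hφ hψ => exact hφ.imp hψ
    | @all n φ hφ =>
      refine all (P := fun (z : α ⊕ Fin n → M) y =>
        φ.Realize (fun i => z (.inl i)) (Fin.snoc (fun i => z (.inr i)) y)) ?_
      refine (hφ.reindex (Sum.elim (fun i => .inl (.inl i))
        (Fin.snoc (α := fun _ => (α ⊕ Fin n) ⊕ Unit) (fun i => .inl (.inr i)) (.inr ())))).congr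
        fun z => ?_
      refine iff_of_eq (congrArg (φ.Realize _) (funext fun k => ?_))
      refine Fin.lastCases ?_ (fun k => ?_) k <;> simp
  obtain ⟨φ, hφ⟩ := hP
  refine ((key φ).reindex (Sum.elim id Fin.elim0)).congr fun x => (hφ x).symm.trans ?_
  exact iff_of_eq (congrArg (BoundedFormula.Realize φ x) (Subsingleton.elim _ _))

end DefinablePred

theorem concepts_subset_of_subset (h : B ⊆ concepts C) : concepts B ⊆ concepts C := fun _ hR =>
  mem_concepts_iff.2 ((mem_concepts_iff.1 hR).of_subset_concepts h)

theorem subset_concepts (B : Set (FinRel M)) : B ⊆ concepts B := fun _ hR =>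
  mem_concepts_iff.2 (DefinablePred.rel hR id)

theorem concepts_mono (h : B ⊆ C) : concepts B ⊆ concepts C :=
  concepts_subset_of_subset (h.trans (subset_concepts C))

/-- Concepts are invariant under the automorphisms of the model. -/
theorem mem_iff_of_mem_concepts (σ : M ≃ M)
    (hσ : ∀ R ∈ B, ∀ x, (fun i => σ (x i)) ∈ R.2 ↔ x ∈ R.2) {R : FinRel M} (hR : R ∈ concepts B)
    (x : Fin R.1 → M) : (fun i => σ (x i)) ∈ R.2 ↔ x ∈ R.2 := by
  obtain ⟨φ, hφ⟩ := mem_concepts_iff.1 hR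
  let g : M ≃[relLanguage B] M :=
    { σ with
      map_fun' := fun f => f.elim
      map_rel' := fun R x => hσ _ R.2 x }
  exact (hφ _).symm.trans ((StrongHomClass.realize_formula g φ (v := x)).trans (hφ x))

end DefinablePredicates

/-! ### Affine notions definable from betweenness -/

section Affine

variable {F : Type*} [Field F] {d : ℕ}

/-- The point `x` lies on the line through `a` and `b`; if `a = b` this "line" is just `{a}`. -/
def OnLine (a b x : Fin d → F) : Prop := ∃ t : F, x = a + t • (b - a)

/-- The points `a`, `b`, `c` form a nondegenerate triangle. -/
def Noncollinear (a b c : Fin d → F) : Prop := a ≠ b ∧ ¬ OnLine a b c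

theorem Noncollinear.eq_zero {a b c : Fin d → F} (h : Noncollinear a b c) {β γ : F}
    (e : β • (b - a) + γ • (c - a) = 0) : β = 0 ∧ γ = 0 := by
  have hγ : γ = 0 := by
    by_contra hγ
    refine h.2 ⟨-(γ⁻¹ * β), ?_⟩
    have e' : c - a = -(γ⁻¹ * β) • (b - a) := by
      have := congrArg (γ⁻¹ • ·) e
      simp only [smul_add, smul_smul, inv_mul_cancel₀ hγ, one_smul, smul_zero] at this
      linear_combination (norm := module) this
    rw [← e']; abel
  subst hγ
  rw [zero_smul, add_zero, smul_eq_zero] at e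
  exact ⟨e.resolve_right (sub_ne_zero.2 h.1.symm), rfl⟩

theorem noncollinear_of_eq_zero {a b c : Fin d → F}
    (h : ∀ β γ : F, β • (b - a) + γ • (c - a) = 0 → β = 0 ∧ γ = 0) : Noncollinear a b c := by
  refine ⟨?_, ?_⟩
  · rintro rfl
    exact one_ne_zero (h 1 0 (by simp)).1
  · rintro ⟨t, rfl⟩
    exact one_ne_zero (h (-t) 1 (by module)).2

theorem exists_noncollinear (hd : 2 ≤ d) {a b : Fin d → F} (hab : a ≠ b) :
    ∃ c, Noncollinear a b c := by
  obtain ⟨i, hi⟩ := Function.ne_iff.1 hab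
  have hi : b i - a i ≠ 0 := sub_ne_zero.2 (Ne.symm hi)
  have : Nontrivial (Fin d) := Fin.nontrivial_iff_two_le.2 hd
  obtain ⟨j, hj⟩ := exists_ne i
  refine ⟨a + Pi.single j 1, noncollinear_of_eq_zero fun β γ e => ?_⟩
  have h1 := congrFun e i
  simp [hj.symm, hi] at h1
  have h2 := congrFun e j
  simp [h1] at h2
  exact ⟨h1, h2⟩

/-- In the plane of a triangle `a b c`, the point `c + (b - a)` is the only one whose joins with `c`
and `b` miss the lines `a b` and `a c` respectively. -/
theorem parallelogram_iff_of_noncollinear [NeZero (2 : F)] {a b c x : Fin d → F}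
    (h : Noncollinear a b c) :
    x - c = b - a ↔ (∃ p q, OnLine a b p ∧ OnLine a c q ∧ OnLine p q x) ∧
      (¬ ∃ y, OnLine a b y ∧ OnLine c x y) ∧ ¬ ∃ y, OnLine a c y ∧ OnLine b x y := by
  have h2 : (2 : F) ≠ 0 := NeZero.ne 2
  constructor
  · intro hx
    obtain rfl : x = c + (b - a) := by rw [← hx]; abel
    refine ⟨⟨_, _, ⟨2, rfl⟩, ⟨2, rfl⟩, 2⁻¹, ?_⟩, ?_, ?_⟩
    · match_scalars <;> field_simp <;> ring
    · rintro ⟨y, ⟨t, rfl⟩, s, hs⟩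
      have := (h.eq_zero (β := t - s) (γ := -1) (by linear_combination (norm := module) hs)).2
      simp at this
    · rintro ⟨y, ⟨t, rfl⟩, s, hs⟩
      have := (h.eq_zero (β := -1) (γ := t - s) (by linear_combination (norm := module) hs)).1
      simp at this
  · rintro ⟨⟨p, q, ⟨r, rfl⟩, ⟨s, rfl⟩, t, rfl⟩, h3, h4⟩
    -- the coordinates of `x` in the frame `a`, `b`, `c`
    obtain ⟨β, hβ⟩ : ∃ β, β = (1 - t) * r := ⟨_, rfl⟩
    obtain ⟨γ, hγ⟩ : ∃ γ, γ = t * s := ⟨_, rfl⟩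
    have hx : a + r • (b - a) + t • (a + s • (c - a) - (a + r • (b - a))) =
        a + (β • (b - a) + γ • (c - a)) := by
      rw [hβ, hγ]; module
    rw [hx] at h3 h4 ⊢
    have hγ1 : γ = 1 := by
      by_contra hne
      have hne : 1 - γ ≠ 0 := sub_ne_zero.2 (Ne.symm hne)
      refine h3 ⟨_, ⟨β * (1 - γ)⁻¹, rfl⟩, (1 - γ)⁻¹, ?_⟩
      match_scalars <;> field_simp <;> ring
    have hβ1 : β = 1 := by
      by_contra hne
      have hne : 1 - β ≠ 0 := sub_ne_zero.2 (Ne.symm hne)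
      refine h4 ⟨_, ⟨γ * (1 - β)⁻¹, rfl⟩, (1 - β)⁻¹, ?_⟩
      match_scalars <;> field_simp <;> ring
    rw [hγ1, hβ1]; module

/-- An arbitrary parallelogram, possibly degenerate, is the difference of two nondegenerate ones
that share a side `u v`. -/
theorem parallelogram_iff [NeZero (2 : F)] (hd : 2 ≤ d) {a b c x : Fin d → F} :
    x - c = b - a ↔ (a = b ∧ c = x) ∨ ∃ u v, (Noncollinear a b u ∧ v - u = b - a) ∧
      (Noncollinear c x u ∧ v - u = x - c) := by
  have h2 : (2 : F) ≠ 0 := NeZero.ne 2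
  constructor
  · intro h
    obtain rfl : x = c + (b - a) := by rw [← h]; abel
    by_cases hab : a = b
    · subst hab; exact .inl ⟨rfl, by simp⟩
    refine .inr ?_
    by_cases hc : OnLine a b c
    · obtain ⟨u, hu⟩ := exists_noncollinear hd hab
      refine ⟨u, u + (b - a), ⟨hu, by abel⟩, noncollinear_of_eq_zero fun β γ e => ?_, by abel⟩
      obtain ⟨t, rfl⟩ := hc
      have := hu.eq_zero (β := β - γ * t) (γ := γ) (by linear_combination (norm := module) e)
      obtain ⟨h1, rfl⟩ := this
      simpa using h1
    · -- reflecting `a` in `c` gives a point off both parallel lines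
      have hc : Noncollinear a b c := ⟨hab, hc⟩
      refine ⟨c + (c - a), c + (c - a) + (b - a), ⟨noncollinear_of_eq_zero fun β γ e => ?_, by abel⟩,
        noncollinear_of_eq_zero fun β γ e => ?_, by abel⟩
      · have := hc.eq_zero (β := β) (γ := γ * 2) (by linear_combination (norm := module) e)
        simpa [h2] using this
      · exact hc.eq_zero (by linear_combination (norm := module) e)
  · rintro (⟨rfl, rfl⟩ | ⟨u, v, ⟨-, h⟩, -, h'⟩)
    · simp
    · rw [← h, ← h']

/-- The intercept theorem for a nondegenerate triangle `o e p`: points on the sides `o e` and `o p`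
divide them in the same ratio iff their join is parallel to `e p`. -/
theorem sameRatio_iff_of_noncollinear {o e p y q : Fin d → F} (h : Noncollinear o e p) :
    (∃ t : F, y - o = t • (e - o) ∧ q - o = t • (p - o)) ↔ OnLine o e y ∧ OnLine o p q ∧
      ((y = e ∧ q = p) ∨ ¬ ∃ x, OnLine e p x ∧ OnLine y q x) := by
  constructor
  · rintro ⟨t, hy, hq⟩
    obtain rfl : y = o + t • (e - o) := by rw [← hy]; abel
    obtain rfl : q = o + t • (p - o) := by rw [← hq]; abel
    refine ⟨⟨t, rfl⟩, ⟨t, rfl⟩, ?_⟩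
    by_cases ht : t = 1
    · subst ht; left; constructor <;> module
    · right
      rintro ⟨x, ⟨r, rfl⟩, s, hs⟩
      have := h.eq_zero (β := (1 - r) - (1 - s) * t) (γ := r - s * t)
        (by linear_combination (norm := module) hs)
      exact ht (by linear_combination - this.1 - this.2)
  · rintro ⟨⟨s, rfl⟩, ⟨t, rfl⟩, ⟨hy, hq⟩ | hx⟩
    · exact ⟨1, by rw [hy, one_smul], by rw [hq, one_smul]⟩
    · obtain rfl : s = t := by
        by_contra hne
        have hne : t - s ≠ 0 := sub_ne_zero.2 (Ne.symm hne)
        refine hx ⟨_, ⟨(1 - s) / (t - s) * t, rfl⟩, (1 - s) / (t - s), ?_⟩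
        match_scalars <;> field_simp <;> ring
      exact ⟨s, by abel, by abel⟩

/-- On collinear triples the equality of ratios is transported through a point `w` off the line, by
two applications of the nondegenerate case. -/
theorem sameRatio_iff (hd : 2 ≤ d) {o e p y q : Fin d → F} (he : o ≠ e) :
    (∃ t : F, y - o = t • (e - o) ∧ q - o = t • (p - o)) ↔
      (p = o ∧ q = o ∧ OnLine o e y) ∨
      ∃ w z, (Noncollinear o e w ∧ ∃ t : F, y - o = t • (e - o) ∧ z - o = t • (w - o)) ∧
        (Noncollinear o w p ∧ ∃ t : F, z - o = t • (w - o) ∧ q - o = t • (p - o)) := by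
  constructor
  · rintro ⟨t, hy, hq⟩
    by_cases hp : p = o
    · subst hp
      refine .inl ⟨rfl, ?_, t, ?_⟩
      · rw [sub_self, smul_zero] at hq
        exact sub_eq_zero.1 hq
      · rw [← hy]; abel
    right
    -- an auxiliary point outside both of the lines `o e` and `o p`
    obtain ⟨w, hw, hw'⟩ : ∃ w, Noncollinear o e w ∧ Noncollinear o w p := by
      by_cases hep : OnLine o e p
      · obtain ⟨w, hw⟩ := exists_noncollinear hd he
        obtain ⟨s, rfl⟩ := hep
        have hs : s ≠ 0 := by rintro rfl; simp at hp
        refine ⟨w, hw, noncollinear_of_eq_zero fun β γ h => ?_⟩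
        have := hw.eq_zero (β := γ * s) (γ := β) (by linear_combination (norm := module) h)
        simpa [hs, and_comm] using this
      · have hep : Noncollinear o e p := ⟨he, hep⟩
        refine ⟨e + (p - o), noncollinear_of_eq_zero fun β γ h => ?_,
          noncollinear_of_eq_zero fun β γ h => ?_⟩
        · obtain ⟨h1, h2⟩ := hep.eq_zero (β := β + γ) (γ := γ) (by linear_combination (norm := module) h)
          subst h2; simpa using h1
        · obtain ⟨h1, h2⟩ := hep.eq_zero (β := β) (γ := β + γ) (by linear_combination (norm := module) h)
          subst h1; simpa using h2
    exact ⟨w, o + t • (w - o), ⟨hw, t, hy, by abel⟩, hw', t, by abel, hq⟩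
  · rintro (⟨rfl, rfl, t, rfl⟩ | ⟨w, z, ⟨hw, t, hy, hz⟩, -, s, hz', hq⟩)
    · exact ⟨t, by abel, by simp⟩
    · have hwo : w - o ≠ 0 := by
        rw [sub_ne_zero]
        rintro rfl
        exact hw.2 ⟨0, by simp⟩
      obtain rfl : t = s := smul_left_injective F hwo (hz.symm.trans hz')
      exact ⟨t, hy, hq⟩

variable [LinearOrder F]

theorem onLine_iff [IsStrictOrderedRing F] {a b x : Fin d → F} :
    OnLine a b x ↔ (∃ t : F, 0 ≤ t ∧ t ≤ 1 ∧ x = a + t • (b - a)) ∨ (¬ a = b ∧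
      ((∃ t : F, 0 ≤ t ∧ t ≤ 1 ∧ a = x + t • (b - x)) ∨
        ∃ t : F, 0 ≤ t ∧ t ≤ 1 ∧ b = a + t • (x - a))) := by
  constructor
  · rintro ⟨t, rfl⟩
    by_cases hab : a = b
    · subst hab; exact .inl ⟨0, le_rfl, zero_le_one, by simp⟩
    rcases lt_or_ge t 0 with ht | ht
    · refine .inr ⟨hab, .inl ⟨-t / (1 - t), div_nonneg (by linarith) (by linarith), ?_, ?_⟩⟩
      · rw [div_le_one (by linarith)]; linarith
      · have : 1 - t ≠ 0 := by linarith
        match_scalars <;> field_simp <;> ring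
    · rcases le_or_gt t 1 with ht1 | ht1
      · exact .inl ⟨t, ht, ht1, rfl⟩
      · refine .inr ⟨hab, .inr ⟨t⁻¹, inv_nonneg.2 ht, inv_le_one_of_one_le₀ ht1.le, ?_⟩⟩
        have : t ≠ 0 := by linarith
        match_scalars <;> field_simp
        ring
  · rintro (⟨t, -, -, rfl⟩ | ⟨hab, ⟨t, -, -, h⟩ | ⟨t, -, -, h⟩⟩)
    · exact ⟨t, rfl⟩
    · have ht : 1 - t ≠ 0 := by
        intro ht
        obtain rfl : t = 1 := by linear_combination -ht
        exact hab (by rw [h]; module)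
      refine ⟨-t / (1 - t), ?_⟩
      have h' : x = (1 - t)⁻¹ • (a - t • b) := by
        rw [eq_inv_smul_iff₀ ht]; linear_combination (norm := module) -h
      rw [h']
      match_scalars <;> field_simp
      ring
    · have ht : t ≠ 0 := by
        rintro rfl
        exact hab (by rw [h]; module)
      refine ⟨t⁻¹, ?_⟩
      have h' : b - a = t • (x - a) := by linear_combination (norm := module) h
      rw [h', smul_smul, inv_mul_cancel₀ ht]; module

end Affine

section AffineDefinability

variable {F : Type*} [Field F] {d : ℕ} {B : Set (FinRel (Fin d → F))} {α : Type}

/-- A vector-valued function `f` of the variables is definable if the point `x o + f x` depends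
definably on `x`. Vectors have to be attached to a variable point `o`, as no point of the space is
distinguished. -/
def DefinableVec (B : Set (FinRel (Fin d → F))) (o : α) (f : (α → Fin d → F) → Fin d → F) : Prop :=
  DefinablePred B fun z : α ⊕ Unit → Fin d → F => z (.inr ()) - z (.inl o) = f fun i => z (.inl i)

namespace DefinableVec

variable {o : α} {f g : (α → Fin d → F) → Fin d → F}

theorem substitute (hf : DefinableVec B o f) {β : Type} (v : α → β) (k : β) :
    DefinablePred B fun z : β → Fin d → F => z k - z (v o) = f fun i => z (v i) :=
  hf.reindex (Sum.elim v fun _ => k)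

theorem eq (hf : DefinableVec B o f) (hg : DefinableVec B o g) :
    DefinablePred B fun x => f x = g x := by
  refine DefinablePred.congr (P := fun x => ∃ a, a - x o = f x ∧ a - x o = g x)
    (.ex (.and hf hg)) fun x => ⟨fun h => ⟨x o + f x, by abel, by rw [h]; abel⟩, ?_⟩
  rintro ⟨a, h, h'⟩
  rw [← h, ← h']

end DefinableVec

variable [LinearOrder F]

theorem DefinablePred.between (hB : Bw F d ∈ concepts B) (i j k : α) :
    DefinablePred B fun x : α → Fin d → F =>
      ∃ t : F, 0 ≤ t ∧ t ≤ 1 ∧ x j = x i + t • (x k - x i) :=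
  DefinablePred.concept hB ![i, j, k]

variable [IsStrictOrderedRing F]

namespace DefinablePred

theorem onLine (hB : Bw F d ∈ concepts B) (i j k : α) :
    DefinablePred B fun x : α → Fin d → F => OnLine (x i) (x j) (x k) :=
  ((between hB i k j).or ((eq i j).not.and ((between hB k i j).or (between hB i j k)))).congr
    fun _ => onLine_iff

theorem noncollinear (hB : Bw F d ∈ concepts B) (i j k : α) :
    DefinablePred B fun x : α → Fin d → F => Noncollinear (x i) (x j) (x k) :=
  (eq i j).not.and (onLine hB i j k).not

theorem noncollinear_and_parallelogram (hB : Bw F d ∈ concepts B) (i j k l : α) :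
    DefinablePred B fun x : α → Fin d → F =>
      Noncollinear (x i) (x j) (x k) ∧ x l - x k = x j - x i := by
  refine DefinablePred.congr (P := fun x => Noncollinear (x i) (x j) (x k) ∧
    (∃ p q, OnLine (x i) (x j) p ∧ OnLine (x i) (x k) q ∧ OnLine p q (x l)) ∧
      (¬ ∃ y, OnLine (x i) (x j) y ∧ OnLine (x k) (x l) y) ∧
      ¬ ∃ y, OnLine (x i) (x k) y ∧ OnLine (x j) (x l) y) ?_
    fun x => and_congr_right fun h => parallelogram_iff_of_noncollinear h
  refine (noncollinear hB _ _ _).and (and (ex (ex ?_)) (and (ex ?_).not (ex ?_).not))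
  · exact (onLine hB _ _ _).and ((onLine hB _ _ _).and (onLine hB _ _ _))
  · exact (onLine hB _ _ _).and (onLine hB _ _ _)
  · exact (onLine hB _ _ _).and (onLine hB _ _ _)

theorem parallelogram (hd : 2 ≤ d) (hB : Bw F d ∈ concepts B) (i j k l : α) :
    DefinablePred B fun x : α → Fin d → F => x l - x k = x j - x i := by
  refine DefinablePred.congr ?_ fun x => parallelogram_iff hd
  exact ((eq _ _).and (eq _ _)).or (ex (ex ((noncollinear_and_parallelogram hB _ _ _ _).and
    (noncollinear_and_parallelogram hB _ _ _ _))))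

theorem noncollinear_and_sameRatio (hB : Bw F d ∈ concepts B) (o e p y q : α) :
    DefinablePred B fun x : α → Fin d → F => Noncollinear (x o) (x e) (x p) ∧
      ∃ t : F, x y - x o = t • (x e - x o) ∧ x q - x o = t • (x p - x o) := by
  refine DefinablePred.congr ?_ fun x => and_congr_right fun h => sameRatio_iff_of_noncollinear h
  exact (noncollinear hB _ _ _).and ((onLine hB _ _ _).and ((onLine hB _ _ _).and
    (((eq _ _).and (eq _ _)).or (ex ((onLine hB _ _ _).and (onLine hB _ _ _))).not)))

theorem sameRatio (hd : 2 ≤ d) (hB : Bw F d ∈ concepts B) (o e p y q : α) :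
    DefinablePred B fun x : α → Fin d → F => x o ≠ x e ∧
      ∃ t : F, x y - x o = t • (x e - x o) ∧ x q - x o = t • (x p - x o) := by
  refine DefinablePred.congr ?_ fun x => and_congr_right fun h => sameRatio_iff hd h
  exact (eq _ _).not.and (((eq _ _).and ((eq _ _).and (onLine hB _ _ _))).or
    (ex (ex ((noncollinear_and_sameRatio hB _ _ _ _ _).and
      (noncollinear_and_sameRatio hB _ _ _ _ _)))))

end DefinablePred

namespace DefinableVec

variable {o : α} {f g : (α → Fin d → F) → Fin d → F}

theorem sub_points (hd : 2 ≤ d) (hB : Bw F d ∈ concepts B) (i j : α) :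
    DefinableVec B o fun x => x i - x j :=
  DefinablePred.parallelogram hd hB _ _ _ _

theorem zero (hd : 2 ≤ d) (hB : Bw F d ∈ concepts B) : DefinableVec B o fun _ => 0 :=
  (sub_points (o := o) hd hB o o).congr fun _ => by simp

theorem add (hd : 2 ≤ d) (hB : Bw F d ∈ concepts B) (hf : DefinableVec B o f)
    (hg : DefinableVec B o g) : DefinableVec B o fun x => f x + g x := by
  refine DefinablePred.congr (P := fun z => ∃ a b, a - z (.inl o) = (f fun i => z (.inl i)) ∧
    b - z (.inl o) = (g fun i => z (.inl i)) ∧ b - z (.inl o) = z (.inr ()) - a) ?_ fun z => ?_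
  · refine .ex (.ex (.and ?_ (.and ?_ ?_)))
    · exact hf.substitute (fun i => Sum.inl (Sum.inl (Sum.inl i))) _
    · exact hg.substitute (fun i => Sum.inl (Sum.inl (Sum.inl i))) _
    · exact DefinablePred.parallelogram hd hB _ _ _ _
  · constructor
    · intro h
      refine ⟨z (.inl o) + f _, z (.inl o) + g _, by abel, by abel, ?_⟩
      linear_combination (norm := module) -h
    · rintro ⟨a, b, ha, hb, h⟩
      linear_combination (norm := module) ha + hb - h

theorem neg (hd : 2 ≤ d) (hB : Bw F d ∈ concepts B) (hf : DefinableVec B o f) :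
    DefinableVec B o fun x => - f x := by
  refine DefinablePred.congr (P := fun z => ∃ a, a - z (.inl o) = (f fun i => z (.inl i)) ∧
    a - z (.inl o) = z (.inl o) - z (.inr ())) ?_ fun z => ?_
  · refine .ex (.and ?_ ?_)
    · exact hf.substitute (fun i => Sum.inl (Sum.inl i)) _
    · exact DefinablePred.parallelogram hd hB _ _ _ _
  · constructor
    · intro h
      refine ⟨z (.inl o) + f _, by abel, ?_⟩
      linear_combination (norm := module) h
    · rintro ⟨a, ha, h⟩
      linear_combination (norm := module) h - ha

theorem nsmul (hd : 2 ≤ d) (hB : Bw F d ∈ concepts B) (hf : DefinableVec B o f) (n : ℕ) :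
    DefinableVec B o fun x => n • f x := by
  induction n with
  | zero => simpa using zero hd hB
  | succ n ih => simpa only [succ_nsmul] using add hd hB ih hf

theorem zsmul (hd : 2 ≤ d) (hB : Bw F d ∈ concepts B) (hf : DefinableVec B o f) (n : ℤ) :
    DefinableVec B o fun x => n • f x := by
  cases n with
  | ofNat n => simpa using nsmul hd hB hf n
  | negSucc n => simpa only [negSucc_zsmul] using neg hd hB (nsmul hd hB hf (n + 1))

theorem sum (hd : 2 ≤ d) (hB : Bw F d ∈ concepts B) {ι : Type*} (s : Finset ι)
    {f : ι → (α → Fin d → F) → Fin d → F} (hf : ∀ i, DefinableVec B o (f i)) :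
    DefinableVec B o fun x => ∑ i ∈ s, f i x := by
  classical
  induction s using Finset.induction_on with
  | empty => simpa using zero hd hB
  | insert i s hi ih => simpa only [Finset.sum_insert hi] using add hd hB (hf i) ih

end DefinableVec

end AffineDefinability

/-! ### The Euclidean and the Minkowski bilinear form -/

section Forms

variable {F : Type*} [Field F] {d : ℕ}

/-- The diagonal bilinear form `∑ εᵢ vᵢ wᵢ` with integer coefficients `ε`. -/
def diagForm (F : Type*) [Field F] (ε : Fin d → ℤ) : LinearMap.BilinForm F (Fin d → F) :=
  LinearMap.mk₂ F (fun v w => ∑ i, ε i * (v i * w i))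
    (fun v v' w => by simp [add_mul, mul_add, Finset.sum_add_distrib])
    (fun c v w => by simp only [Pi.smul_apply, smul_eq_mul, Finset.mul_sum]; congr! 1; ring)
    (fun v w w' => by simp [mul_add, Finset.sum_add_distrib])
    (fun c v w => by simp only [Pi.smul_apply, smul_eq_mul, Finset.mul_sum]; congr! 1; ring)

theorem diagForm_apply (ε : Fin d → ℤ) (v w : Fin d → F) :
    diagForm F ε v w = ∑ i, ε i * (v i * w i) := rfl

theorem diagForm_comm (ε : Fin d → ℤ) (v w : Fin d → F) :
    diagForm F ε v w = diagForm F ε w v := by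
  simp only [diagForm_apply, mul_comm (v _)]

theorem diagForm_single_left (ε : Fin d → ℤ) (i : Fin d) (w : Fin d → F) :
    diagForm F ε (Pi.single i 1) w = ε i * w i := by
  rw [diagForm_apply, Finset.sum_eq_single i] <;> simp +contextual

theorem diagForm_single_right (ε : Fin d → ℤ) (i : Fin d) (v : Fin d → F) :
    diagForm F ε v (Pi.single i 1) = ε i * v i := by
  rw [diagForm_comm, diagForm_single_left]

/-- In an orthogonal basis whose vectors `eᵢ` have squared length `εᵢ m`, the form `diagForm ε` is
`m` times its standard expression. -/
theorem diagForm_sum_smul {ε : Fin d → ℤ} {e : Fin d → Fin d → F} {m : F}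
    (he : ∀ i j, diagForm F ε (e i) (e j) = if i = j then ε i * m else 0) (a : Fin d → F) :
    diagForm F ε (∑ i, a i • e i) (∑ i, a i • e i) = m * ∑ i, ε i * a i ^ 2 := by
  simp only [map_sum, LinearMap.sum_apply, map_smul, LinearMap.smul_apply, he, smul_eq_mul,
    mul_ite, mul_zero, Finset.mem_univ, if_true, Finset.mul_sum,
    Finset.sum_ite_eq']
  exact Finset.sum_congr rfl fun i _ => by ring

/-- The Euclidean scalar product. -/
abbrev euclForm (F : Type*) [Field F] (d : ℕ) : LinearMap.BilinForm F (Fin d → F) :=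
  diagForm F fun _ => 1

theorem sqEuclDist_eq (p q : Fin d → F) : sqEuclDist p q = euclForm F d (p - q) (p - q) := by
  rw [sqEuclDist, scalarProd, diagForm_apply]
  simp

variable [NeZero d]

/-- The coefficients `1, -1, …, -1` of the Minkowski form. -/
def minkSign (d : ℕ) [NeZero d] (i : Fin d) : ℤ := if i = 0 then 1 else -1

/-- The Minkowski product. -/
abbrev minkForm (F : Type*) [Field F] (d : ℕ) [NeZero d] : LinearMap.BilinForm F (Fin d → F) :=
  diagForm F (minkSign d)

theorem minkForm_apply (v w : Fin d → F) : minkForm F d v w = minkProd v w := by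
  rw [diagForm_apply, ← Finset.add_sum_erase _ _ (Finset.mem_univ (0 : Fin d)), minkProd,
    sub_eq_add_neg, ← Finset.sum_neg_distrib]
  refine congrArg₂ _ (by simp [minkSign]) (Finset.sum_congr rfl fun i hi => ?_)
  simp [minkSign, Finset.ne_of_mem_erase hi]

theorem sqMinkDist_eq (p q : Fin d → F) : sqMinkDist p q = minkForm F d (p - q) (p - q) :=
  (minkForm_apply _ _).symm

theorem lightlike_iff (x : Fin 2 → Fin d → F) :
    x ∈ (Lightlike F d).2 ↔ minkForm F d (x 0 - x 1) (x 0 - x 1) = 0 := by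
  rw [minkForm_apply, minkProd, sub_eq_zero]
  simp only [← pow_two]
  rfl

/-- The two forms coincide up to sign on spatial vectors. -/
theorem euclForm_eq (v w : Fin d → F) :
    euclForm F d v w = 2 * (v 0 * w 0) - minkForm F d v w := by
  rw [eq_sub_iff_add_eq, diagForm_apply, diagForm_apply, ← Finset.sum_add_distrib,
    Finset.sum_eq_single (0 : Fin d)]
  · simp [minkSign, two_mul]
  · intro i _ hi
    simp [minkSign, hi]
  · simp

end Forms

/-! ### Coordinates with respect to a definable frame -/

section Frames

variable {F : Type*} [Field F] {d : ℕ} [NeZero d]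

/-- The vector `p - q` has some coordinates `a` with respect to the vectors `E i - o`, and `w` codes
the scalar `∑ εᵢ aᵢ²` on the line through `o` and `E 0`. -/
def FrameSquare (ε : Fin d → ℤ) (o : Fin d → F) (E : Fin d → Fin d → F) (p q w : Fin d → F) : Prop :=
  ∃ a : Fin d → F, p - q = ∑ i, a i • (E i - o) ∧ w - o = ∑ i, ε i • a i ^ 2 • (E 0 - o)

/-- Multiplication of scalars becomes affine: with `A i` the point coding `aᵢ`, the vector
`aᵢ (E i - o)` and the point coding `aᵢ²` are found by copying the ratio `aᵢ`. -/
theorem frameSquare_iff {ε : Fin d → ℤ} {o : Fin d → F} {E : Fin d → Fin d → F} {p q w : Fin d → F}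
    (h : o ≠ E 0) :
    FrameSquare ε o E p q w ↔ ∃ A C S : Fin d → Fin d → F,
      (∀ i, (o ≠ E 0 ∧ ∃ t : F, A i - o = t • (E 0 - o) ∧ C i - o = t • (E i - o)) ∧
        (o ≠ E 0 ∧ ∃ t : F, A i - o = t • (E 0 - o) ∧ S i - o = t • (A i - o))) ∧
      p - q = ∑ i, (C i - o) ∧ w - o = ∑ i, ε i • (S i - o) := by
  constructor
  · rintro ⟨a, hpq, hw⟩
    refine ⟨fun i => o + a i • (E 0 - o), fun i => o + a i • (E i - o),
      fun i => o + a i ^ 2 • (E 0 - o), fun i => ⟨⟨h, a i, by simp, by simp⟩, h, a i, by simp, ?_⟩,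
      by simpa using hpq, by simpa using hw⟩
    simp [smul_smul, pow_two]
  · rintro ⟨A, C, S, hACS, hpq, hw⟩
    choose hC hS using hACS
    choose a ha hC using fun i => (hC i).2
    choose b hb hS using fun i => (hS i).2
    have hab : ∀ i, b i = a i := fun i =>
      smul_left_injective F (sub_ne_zero.2 h.symm) ((hb i).symm.trans (ha i))
    refine ⟨a, by simpa only [hC] using hpq, hw.trans (Finset.sum_congr rfl fun i _ => ?_)⟩
    rw [hS, ha, hab, smul_smul, pow_two]

variable {B : Set (FinRel (Fin d → F))} {α : Type}

theorem DefinableVec.lightlike (hL : Lightlike F d ∈ concepts B) {o : α}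
    {f : (α → Fin d → F) → Fin d → F} (hf : DefinableVec B o f) :
    DefinablePred B fun x => minkForm F d (f x) (f x) = 0 := by
  refine DefinablePred.congr (P := fun x => ∃ a, a - x o = f x ∧ ![a, x o] ∈ (Lightlike F d).2)
    (.ex (.and hf ?_)) fun x => ?_
  · refine (DefinablePred.concept hL ![Sum.inr (), Sum.inl o]).congr fun z => ?_
    exact iff_of_eq (congrArg (· ∈ (Lightlike F d).2) (funext fun k => by fin_cases k <;> rfl))
  · simp only [lightlike_iff, Matrix.cons_val_zero, Matrix.cons_val_one]
    constructor
    · exact fun h => ⟨x o + f x, by abel, by simpa using h⟩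
    · rintro ⟨a, ha, h⟩
      rwa [← ha]

variable [LinearOrder F] [IsStrictOrderedRing F]

theorem DefinablePred.frameSquare (hd : 2 ≤ d) (hB : Bw F d ∈ concepts B) (ε : Fin d → ℤ) (o : α)
    (E : Fin d → α) (p q w : α) :
    DefinablePred B fun x : α → Fin d → F => x o ≠ x (E 0) ∧
      FrameSquare ε (x o) (fun i => x (E i)) (x p) (x q) (x w) := by
  refine DefinablePred.congr ?_ fun x => and_congr_right fun h => frameSquare_iff h
  refine (eq _ _).not.and (exists_fun (exists_fun (exists_fun (.and
    (forall_finite fun i => .and ?_ ?_) (.and ?_ ?_)))))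
  · exact sameRatio hd hB _ _ _ _ _
  · exact sameRatio hd hB _ _ _ _ _
  · exact DefinableVec.eq (o := Sum.inl (Sum.inl (Sum.inl o))) (.sub_points hd hB _ _)
      (.sum hd hB _ fun i => .sub_points hd hB _ _)
  · exact DefinableVec.eq (o := Sum.inl (Sum.inl (Sum.inl o))) (.sub_points hd hB _ _)
      (.sum hd hB _ fun i => .zsmul hd hB (.sub_points hd hB _ _) _)

/-- If there is a definable notion of frame all of whose members are orthogonal bases for
`diagForm ε`, up to a common scale `m`, then equality of `ε`-lengths is a concept. -/
theorem diagForm_congruence_mem_concepts (hd : 2 ≤ d) (hB : Bw F d ∈ concepts B) {ε : Fin d → ℤ}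
    {Fr : (Fin d → F) → (Fin d → Fin d → F) → Prop}
    (hdef : DefinablePred B fun x : Unit ⊕ Fin d → Fin d → F =>
      Fr (x (.inl ())) fun i => x (.inr i))
    (hne : ∀ o E, Fr o E → o ≠ E 0)
    (horth : ∀ o E, Fr o E → ∃ m : F, ∀ i j,
      diagForm F ε (E i - o) (E j - o) = if i = j then ε i * m else 0)
    (hstd : Fr 0 fun i => Pi.single i 1) :
    (⟨4, {x | diagForm F ε (x 0 - x 1) (x 0 - x 1) = diagForm F ε (x 2 - x 3) (x 2 - x 3)}⟩ :
      FinRel (Fin d → F)) ∈ concepts B := by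
  refine mem_concepts_iff.2 (DefinablePred.congr (P := fun x : Fin 4 → Fin d → F =>
    ∃ w o, ∃ E : Fin d → Fin d → F, Fr o E ∧
      (o ≠ E 0 ∧ FrameSquare ε o E (x 0) (x 1) w) ∧
      (o ≠ E 0 ∧ FrameSquare ε o E (x 2) (x 3) w)) ?_ fun x => ?_)
  · refine .ex (.ex (.exists_fun (.and ?_ (.and ?_ ?_))))
    · exact hdef.reindex (Sum.elim (fun _ => Sum.inl (Sum.inr ())) Sum.inr)
    · exact DefinablePred.frameSquare hd hB ε _ Sum.inr _ _ _
    · exact DefinablePred.frameSquare hd hB ε _ Sum.inr _ _ _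
  · change diagForm F ε (x 0 - x 1) (x 0 - x 1) = diagForm F ε (x 2 - x 3) (x 2 - x 3) ↔ _
    constructor
    · intro h
      have key : ∀ p q : Fin d → F, FrameSquare ε 0 (fun i => Pi.single i (1 : F)) p q
          (diagForm F ε (p - q) (p - q) • Pi.single 0 1) := fun p q => by
        refine ⟨p - q, ?_, ?_⟩
        · ext j
          simp [Finset.sum_apply, Pi.single_apply]
        · simp only [sub_zero, diagForm_apply, Finset.sum_smul, ← pow_two, mul_smul,
            Int.cast_smul_eq_zsmul]
      refine ⟨_, _, _, hstd, ⟨hne _ _ hstd, key _ _⟩, hne _ _ hstd, ?_⟩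
      rw [h]
      exact key _ _
    · rintro ⟨w, o, E, hE, ⟨h0, a, ha, hwa⟩, -, b, hb, hwb⟩
      obtain ⟨m, hm⟩ := horth o E hE
      have hsmul : ∀ c : Fin d → F, ∑ i, ε i • c i ^ 2 • (E 0 - o) =
          (∑ i, ε i * c i ^ 2 : F) • (E 0 - o) := fun c => by
        simp only [Finset.sum_smul, mul_smul, Int.cast_smul_eq_zsmul]
      rw [hsmul] at hwa hwb
      rw [ha, hb, diagForm_sum_smul hm, diagForm_sum_smul hm,
        smul_left_injective F (sub_ne_zero.2 h0.symm) (hwa.symm.trans hwb)]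

end Frames

/-! ### Minkowski congruence from lightlike relatedness -/

section Lorentz

variable {F : Type*} [Field F] {d : ℕ} [NeZero d]

/-- Lorentz frames up to scale, described by means of lightlike vectors only. The coefficients of
the last condition come from `3² + 4² = 5²`: it makes the spatial axes orthogonal. -/
def LorentzFrame (o : Fin d → F) (E : Fin d → Fin d → F) : Prop :=
  o ≠ E 0 ∧ ∀ i, i ≠ 0 →
    minkForm F d ((E 0 - o) + (E i - o)) ((E 0 - o) + (E i - o)) = 0 ∧
    minkForm F d (E 0 - E i) (E 0 - E i) = 0 ∧
    ∀ j, j ≠ 0 ∧ j ≠ i → minkForm F d (5 • (E 0 - o) + 3 • (E i - o) + 4 • (E j - o))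
      (5 • (E 0 - o) + 3 • (E i - o) + 4 • (E j - o)) = 0

theorem lorentzFrame_single :
    LorentzFrame (0 : Fin d → F) fun i => Pi.single i 1 := by
  refine ⟨fun h => by simpa using congrFun h 0, fun i hi => ⟨?_, ?_, fun j hj => ?_⟩⟩
  · simp [diagForm_single_left, minkSign, hi, hi.symm]
  · simp [diagForm_single_left, minkSign, hi, hi.symm]
  · simp only [map_add, LinearMap.add_apply, map_nsmul, LinearMap.smul_apply, sub_zero,
      diagForm_single_left, minkSign, Pi.single_apply, hi, hi.symm, hj.1, hj.1.symm, hj.2,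
      hj.2.symm]
    norm_num

variable [LinearOrder F] [IsStrictOrderedRing F]

theorem LorentzFrame.minkForm_eq {o : Fin d → F} {E : Fin d → Fin d → F} (h : LorentzFrame o E) :
    ∃ m : F, ∀ i j, minkForm F d (E i - o) (E j - o) = if i = j then minkSign d i * m else 0 := by
  obtain ⟨-, h⟩ := h
  obtain ⟨e, he⟩ : ∃ e : Fin d → Fin d → F, ∀ i, E i - o = e i := ⟨_, fun _ => rfl⟩
  have he0 : ∀ i, E 0 - E i = e 0 - e i := fun i => by rw [← he, ← he]; abel
  simp only [he, he0] at h ⊢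
  have h1 : ∀ i, i ≠ 0 → minkForm F d (e 0) (e i) = 0 ∧
      minkForm F d (e i) (e i) = - minkForm F d (e 0) (e 0) := by
    intro i hi
    obtain ⟨ha, hb, -⟩ := h i hi
    simp only [map_add, map_sub, LinearMap.add_apply, LinearMap.sub_apply,
      diagForm_comm _ (e i) (e 0)] at ha hb
    constructor <;> linarith
  refine ⟨minkForm F d (e 0) (e 0), fun i j => ?_⟩
  by_cases hi : i = 0
  · subst hi
    by_cases hj : j = 0
    · subst hj; simp [minkSign]
    · simp [h1 j hj, Ne.symm hj]
  by_cases hj : j = 0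
  · subst hj
    rw [diagForm_comm]; simp [h1 i hi, hi]
  by_cases hij : i = j
  · subst hij; simp [minkSign, hi, h1 i hi]
  have hc := (h i hi).2.2 j ⟨hj, Ne.symm hij⟩
  simp only [map_add, LinearMap.add_apply, map_nsmul, LinearMap.smul_apply,
    diagForm_comm _ _ (e 0), diagForm_comm _ (e j) (e i), (h1 i hi).1, (h1 j hj).1,
    (h1 i hi).2, (h1 j hj).2] at hc
  simp only [nsmul_eq_mul] at hc
  push_cast at hc
  rw [if_neg hij]
  linarith

variable {B : Set (FinRel (Fin d → F))}

theorem DefinablePred.lorentzFrame (hd : 2 ≤ d) (hB : Bw F d ∈ concepts B)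
    (hL : Lightlike F d ∈ concepts B) :
    DefinablePred B fun x : Unit ⊕ Fin d → Fin d → F =>
      LorentzFrame (x (.inl ())) fun i => x (.inr i) := by
  have hs : ∀ i j, DefinableVec B (Sum.inl ()) fun x : Unit ⊕ Fin d → Fin d → F => x i - x j :=
    DefinableVec.sub_points hd hB
  refine (eq _ _).not.and (forall_finite fun i => (const _).imp (.and ?_ (.and ?_
    (forall_finite fun j => (const _).imp ?_))))
  · exact ((hs _ _).add hd hB (hs _ _)).lightlike hL
  · exact (hs _ _).lightlike hL
  · exact ((((hs _ _).nsmul hd hB 5).add hd hB ((hs _ _).nsmul hd hB 3)).add hd hB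
      ((hs _ _).nsmul hd hB 4)).lightlike hL

theorem cngMink_mem_concepts (hd : 2 ≤ d) (hB : Bw F d ∈ concepts B)
    (hL : Lightlike F d ∈ concepts B) : CngMink F d ∈ concepts B := by
  have := diagForm_congruence_mem_concepts (ε := minkSign d) hd hB
    (DefinablePred.lorentzFrame hd hB hL) (fun _ _ h => h.1) (fun _ _ h => h.minkForm_eq)
    lorentzFrame_single
  simpa only [CngMink, sqMinkDist_eq] using this

end Lorentz

/-! ### Rest and Euclidean congruence in late classical spacetime -/

section LateClassical

variable {F : Type*} [Field F] {d : ℕ} [NeZero d]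

theorem simul_mem_concepts {B : Set (FinRel (Fin d → F))} (hS : CngSimul F d ∈ concepts B) :
    Simul F d ∈ concepts B := by
  refine mem_concepts_iff.2
    ((DefinablePred.concept hS (![0, 1, 0, 1] : Fin 4 → Fin 2)).congr fun x => ?_)
  change x 0 0 = x 1 0 ↔ _ = _ ∧ x 0 0 = x 1 0 ∧ x 0 0 = x 1 0
  simp

variable [LinearOrder F] [IsStrictOrderedRing F]

/-- The light cone of `p` cuts the simultaneity of `q` in a sphere around the projection of `p`. So
`q` is that projection iff it has the same distance from all points of the sphere. -/
theorem rest_iff {p q : Fin d → F} :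
    (∀ i, i ≠ 0 → p i = q i) ↔ p = q ∨ (¬ p 0 = q 0 ∧ ∀ r r' : Fin d → F,
      r 0 = q 0 ∧ r' 0 = q 0 ∧ minkForm F d (r - p) (r - p) = 0 ∧
        minkForm F d (r' - p) (r' - p) = 0 →
      euclForm F d (q - r) (q - r) = euclForm F d (q - r') (q - r')) := by
  constructor
  · intro h
    by_cases h0 : p 0 = q 0
    · left
      ext i
      by_cases hi : i = 0
      · rw [hi, h0]
      · exact h i hi
    refine .inr ⟨h0, ?_⟩
    have hqp : q = p + (q 0 - p 0) • Pi.single 0 1 := by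
      ext i
      by_cases hi : i = 0
      · subst hi; simp
      · simp [hi, h i hi]
    have key : ∀ r : Fin d → F, r 0 = q 0 → minkForm F d (r - p) (r - p) = 0 →
        euclForm F d (q - r) (q - r) = (q 0 - p 0) ^ 2 := by
      intro r hr hn
      have e : q - r = (q 0 - p 0) • Pi.single 0 1 - (r - p) := by
        nth_rewrite 1 [hqp]; abel
      have hv : (r - p) 0 = q 0 - p 0 := by rw [Pi.sub_apply, hr]
      rw [euclForm_eq, Pi.sub_apply, hr, e]
      generalize r - p = v at hn hv
      simp only [map_sub, LinearMap.sub_apply, map_smul, LinearMap.smul_apply, hn,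
        diagForm_single_left, diagForm_single_right, hv, smul_eq_mul, minkSign,
        if_true, Pi.single_eq_same]
      push_cast
      ring
    rintro r r' ⟨hr, hr', hn, hn'⟩
    rw [key r hr hn, key r' hr' hn']
  · rintro (rfl | ⟨h0, h⟩) i hi
    · rfl
    have hτ : q 0 - p 0 ≠ 0 := sub_ne_zero.2 (Ne.symm h0)
    -- two antipodal points of the sphere, in the direction of the `i`-th axis
    have hn := h (p + (q 0 - p 0) • (Pi.single 0 1 + Pi.single i 1))
      (p + (q 0 - p 0) • (Pi.single 0 1 - Pi.single i 1)) (by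
        simp only [add_sub_cancel_left, map_smul, LinearMap.smul_apply]
        simp [hi, hi.symm, diagForm_single_left, minkSign])
    have e : ∀ s : Fin d → F, q - (p + (q 0 - p 0) • s) = (q - p) - (q 0 - p 0) • s := fun s => by
      abel
    simp only [e, map_sub, map_add, LinearMap.sub_apply, LinearMap.add_apply, map_smul,
      LinearMap.smul_apply, diagForm_single_left, diagForm_single_right, smul_eq_mul,
      Pi.single_apply, hi, hi.symm, if_true, if_false] at hn
    have : (q 0 - p 0) * (p i - q i) = 0 := by push_cast at hn; linarith
    exact sub_eq_zero.1 ((mul_eq_zero.1 this).resolve_left hτ)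

variable {B : Set (FinRel (Fin d → F))}

theorem rest_mem_concepts (hd : 2 ≤ d) (hB : Bw F d ∈ concepts B)
    (hL : Lightlike F d ∈ concepts B) (hS : CngSimul F d ∈ concepts B) :
    Rest F d ∈ concepts B := by
  refine mem_concepts_iff.2 (DefinablePred.congr (P := fun x : Fin 2 → Fin d → F =>
    x 0 = x 1 ∨ (¬ x 0 0 = x 1 0 ∧ ∀ r r' : Fin d → F,
      r 0 = x 1 0 ∧ r' 0 = x 1 0 ∧ minkForm F d (r - x 0) (r - x 0) = 0 ∧
        minkForm F d (r' - x 0) (r' - x 0) = 0 →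
      sqEuclDist (x 1) r = sqEuclDist (x 1) r' ∧ x 1 0 = r 0 ∧ x 1 0 = r' 0)) ?_ fun x => ?_)
  · have hT : ∀ {α : Type} (i j : α), DefinablePred B fun x : α → Fin d → F => x i 0 = x j 0 :=
      fun i j => DefinablePred.concept (simul_mem_concepts hS) ![i, j]
    have hV : ∀ {α : Type} (i j : α), DefinableVec B i fun x : α → Fin d → F => x i - x j :=
      fun i j => DefinableVec.sub_points hd hB i j
    refine (DefinablePred.eq _ _).or ((hT _ _).not.and (.all (.all (.imp (.and ?_ (.and ?_
      (.and ?_ ?_))) ?_))))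
    · exact hT _ _
    · exact hT _ _
    · exact (hV _ _).lightlike hL
    · exact (hV _ _).lightlike hL
    · exact DefinablePred.concept hS ![Sum.inl (Sum.inl 1), Sum.inl (Sum.inr ()),
        Sum.inl (Sum.inl 1), Sum.inr ()]
  · refine rest_iff.trans (or_congr Iff.rfl (and_congr Iff.rfl (forall₂_congr fun r r' => ?_)))
    simp only [sqEuclDist_eq]
    exact forall_congr' fun h => by simp [h.1, h.2.1]

/-- The frames used for the Euclidean form are the Lorentz frames whose axes are spatial, except for
the one with index `0`, which is vertical. -/
theorem cng_mem_concepts (hd : 2 ≤ d) (hB : Bw F d ∈ concepts B)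
    (hL : Lightlike F d ∈ concepts B) (hS : CngSimul F d ∈ concepts B) :
    Cng F d ∈ concepts B := by
  have := diagForm_congruence_mem_concepts (ε := fun _ => 1) (B := B) hd hB
    (Fr := fun o E => LorentzFrame o E ∧ (∀ i, i ≠ 0 → o 0 = E i 0) ∧ ∀ i, i ≠ 0 → o i = E 0 i)
    (((DefinablePred.lorentzFrame hd hB hL)).and (.and
      (.forall_finite fun i => (DefinablePred.const _).imp
        (DefinablePred.concept (simul_mem_concepts hS) ![Sum.inl (), Sum.inr i]))
      (DefinablePred.concept (rest_mem_concepts hd hB hL hS) ![Sum.inl (), Sum.inr 0])))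
    (fun _ _ h => h.1.1) ?_
    ⟨lorentzFrame_single, fun i hi => by simp [hi.symm], fun i hi => by simp [hi]⟩
  · simpa only [Cng, sqEuclDist_eq] using this
  · rintro o E ⟨h, hT, hR⟩
    obtain ⟨m, hm⟩ := h.minkForm_eq
    have h00 : minkForm F d (E 0 - o) (E 0 - o) = (E 0 0 - o 0) * (E 0 0 - o 0) := by
      rw [diagForm_apply, Finset.sum_eq_single 0] <;> simp +contextual [minkSign, hR]
    refine ⟨m, fun i j => ?_⟩
    rw [euclForm_eq, hm]
    by_cases hi : i = 0
    · subst hi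
      by_cases hj : j = 0
      · subst hj
        have := hm 0 0
        simp only [h00, minkSign, if_true] at this
        simp only [Pi.sub_apply, this, minkSign, if_true]
        push_cast; ring
      · simp [Ne.symm hj, hT j hj]
    · by_cases hij : i = j
      · subst hij; simp [hT i hi, minkSign, hi]
      · simp [hT i hi, hij]

end LateClassical

/-! ### Linear maps of a coordinate plane as automorphisms -/

section PlaneMaps

variable {F : Type*} [Field F] {d : ℕ} [NeZero d] {k : Fin d}

/-- For `k ≠ 0`, the point with time coordinate `s`, `k`-th coordinate `t` and all other coordinates
`0`. -/
def planePoint (k : Fin d) (s t : F) : Fin d → F := s • Pi.single 0 1 + t • Pi.single k 1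

theorem planePoint_sub (s t s' t' : F) :
    planePoint k s t - planePoint k s' t' = planePoint k (s - s') (t - t') := by
  simp only [planePoint]; module

theorem planePoint_apply_zero (hk : k ≠ 0) (s t : F) : planePoint k s t 0 = s := by
  simp [planePoint, hk.symm]

theorem planePoint_apply (hk : k ≠ 0) (s t : F) : planePoint k s t k = t := by
  simp [planePoint, hk]

theorem planePoint_apply_of_ne {i : Fin d} (h0 : i ≠ 0) (hi : i ≠ k) (s t : F) :
    planePoint k s t i = 0 := by
  simp [planePoint, h0, hi]

theorem diagForm_planePoint (hk : k ≠ 0) (ε : Fin d → ℤ) (s t : F) :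
    diagForm F ε (planePoint k s t) (planePoint k s t) = ε 0 * s ^ 2 + ε k * t ^ 2 := by
  simp only [planePoint, map_add, LinearMap.add_apply, map_smul, LinearMap.smul_apply,
    diagForm_single_left, Pi.single_apply, hk, hk.symm, smul_eq_mul, if_true, if_false]
  ring

/-- The linear map with matrix `!![a, b; c, e]` in the plane of the coordinates `0` and `k`, which
leaves all other coordinates unchanged; it has this meaning only for `k ≠ 0`. -/
def planeMap (k : Fin d) (a b c e : F) (v : Fin d → F) : Fin d → F :=
  v + planePoint k (a * v 0 + b * v k - v 0) (c * v 0 + e * v k - v k)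

variable {a b c e : F}

theorem planeMap_sub (v w : Fin d → F) :
    planeMap k a b c e (v - w) = planeMap k a b c e v - planeMap k a b c e w := by
  simp only [planeMap, planePoint, Pi.sub_apply]; module

theorem planeMap_add_smul (t : F) (v w : Fin d → F) :
    planeMap k a b c e (v + t • w) = planeMap k a b c e v + t • planeMap k a b c e w := by
  simp only [planeMap, planePoint, Pi.add_apply, Pi.smul_apply, smul_eq_mul]; module

theorem planeMap_apply_zero (hk : k ≠ 0) (v : Fin d → F) :
    planeMap k a b c e v 0 = a * v 0 + b * v k := by
  simp [planeMap, planePoint_apply_zero hk]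

theorem planeMap_apply (hk : k ≠ 0) (v : Fin d → F) :
    planeMap k a b c e v k = c * v 0 + e * v k := by
  simp [planeMap, planePoint_apply hk]

theorem planeMap_apply_of_ne {i : Fin d} (h0 : i ≠ 0) (hi : i ≠ k) (v : Fin d → F) :
    planeMap k a b c e v i = v i := by
  simp [planeMap, planePoint_apply_of_ne h0 hi]

theorem planeMap_planePoint (hk : k ≠ 0) (s t : F) :
    planeMap k a b c e (planePoint k s t) = planePoint k (a * s + b * t) (c * s + e * t) := by
  rw [planeMap, planePoint_apply_zero hk, planePoint_apply hk]
  simp only [planePoint]; module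

theorem diagForm_planeMap (hk : k ≠ 0) (ε : Fin d → ℤ) (v : Fin d → F) :
    diagForm F ε (planeMap k a b c e v) (planeMap k a b c e v) = diagForm F ε v v +
      ε 0 * ((a * v 0 + b * v k) ^ 2 - v 0 ^ 2) + ε k * ((c * v 0 + e * v k) ^ 2 - v k ^ 2) := by
  simp only [planeMap, planePoint, map_add, LinearMap.add_apply, map_smul, LinearMap.smul_apply,
    diagForm_single_left, diagForm_single_right, Pi.single_apply, hk, hk.symm, smul_eq_mul,
    if_true, if_false]
  ring

/-- A nonsingular `planeMap` as a bijection. -/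
def planeEquiv (hk : k ≠ 0) (h : a * e - b * c ≠ 0) : (Fin d → F) ≃ (Fin d → F) where
  toFun := planeMap k a b c e
  invFun := planeMap k (e / (a * e - b * c)) (-b / (a * e - b * c)) (-c / (a * e - b * c))
    (a / (a * e - b * c))
  left_inv v := by
    generalize hD : a * e - b * c = D at h ⊢
    ext i
    by_cases h0 : i = 0
    · subst h0
      rw [planeMap_apply_zero hk, planeMap_apply_zero hk, planeMap_apply hk]
      field_simp; linear_combination v 0 * hD
    by_cases hi : i = k
    · subst hi
      rw [planeMap_apply hk, planeMap_apply_zero hk, planeMap_apply hk]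
      field_simp; linear_combination v i * hD
    · rw [planeMap_apply_of_ne h0 hi, planeMap_apply_of_ne h0 hi]
  right_inv v := by
    generalize hD : a * e - b * c = D at h ⊢
    ext i
    by_cases h0 : i = 0
    · subst h0
      rw [planeMap_apply_zero hk, planeMap_apply_zero hk, planeMap_apply hk]
      field_simp; linear_combination v 0 * hD
    by_cases hi : i = k
    · subst hi
      rw [planeMap_apply hk, planeMap_apply_zero hk, planeMap_apply hk]
      field_simp; linear_combination v i * hD
    · rw [planeMap_apply_of_ne h0 hi, planeMap_apply_of_ne h0 hi]

theorem planeMap_mem_bw_iff [LinearOrder F] (hk : k ≠ 0) (h : a * e - b * c ≠ 0)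
    (x : Fin 3 → Fin d → F) :
    (fun i => planeMap k a b c e (x i)) ∈ (Bw F d).2 ↔ x ∈ (Bw F d).2 := by
  refine exists_congr fun t => and_congr_right fun _ => and_congr_right fun _ => ?_
  rw [← planeMap_sub, ← planeMap_add_smul]
  exact (planeEquiv hk h).injective.eq_iff

variable {B : Set (FinRel (Fin d → F))}

/-- A relation that a plane automorphism of the model takes from some points of the plane of the
coordinates `0` and `k` to points where it fails is not a concept. -/
theorem notMem_concepts_of_planeMap (hk : k ≠ 0) (h : a * e - b * c ≠ 0)
    (hB : ∀ R ∈ B, ∀ x, (fun i => planeMap k a b c e (x i)) ∈ R.2 ↔ x ∈ R.2)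
    {R : FinRel (Fin d → F)} (s t : Fin R.1 → F) (hR : (fun i => planePoint k (s i) (t i)) ∈ R.2)
    (hR' : (fun i => planePoint k (a * s i + b * t i) (c * s i + e * t i)) ∉ R.2) :
    R ∉ concepts B := fun hRB => by
  have := (mem_iff_of_mem_concepts (planeEquiv hk h) hB hRB _).2 hR
  refine hR' ?_
  simpa only [planeEquiv, Equiv.coe_fn_mk, planeMap_planePoint hk] using this

end PlaneMaps

section PlaneRelations

theorem mem_cng_iff {F : Type*} [Field F] {d : ℕ} (x : Fin 4 → Fin d → F) :
    x ∈ (Cng F d).2 ↔ sqEuclDist (x 0) (x 1) = sqEuclDist (x 2) (x 3) := Iff.rfl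

theorem mem_cngMink_iff {F : Type*} [Field F] {d : ℕ} [NeZero d]
    (x : Fin 4 → Fin d → F) :
    x ∈ (CngMink F d).2 ↔ sqMinkDist (x 0) (x 1) = sqMinkDist (x 2) (x 3) := Iff.rfl

theorem mem_cngSimul_iff {F : Type*} [Field F] {d : ℕ} [NeZero d]
    (x : Fin 4 → Fin d → F) :
    x ∈ (CngSimul F d).2 ↔ sqEuclDist (x 0) (x 1) = sqEuclDist (x 2) (x 3) ∧
      x 0 0 = x 1 0 ∧ x 2 0 = x 3 0 := Iff.rfl

theorem mem_simul_iff {F : Type*} {d : ℕ} [NeZero d] (x : Fin 2 → Fin d → F) :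
    x ∈ (Simul F d).2 ↔ x 0 0 = x 1 0 := Iff.rfl

theorem mem_rest_iff {F : Type*} {d : ℕ} [NeZero d] (x : Fin 2 → Fin d → F) :
    x ∈ (Rest F d).2 ↔ ∀ i, i ≠ 0 → x 0 i = x 1 i := Iff.rfl

theorem mem_delta_iff {F : Type*} [Field F] {d : ℕ} [NeZero d]
    (x : Fin 3 → Fin d → F) :
    x ∈ (Delta F d).2 ↔ x 0 0 = x 1 0 ∧ ![x 0, x 2] ∈ (Lightlike F d).2 := Iff.rfl

variable {F : Type*} [Field F] {d : ℕ} [NeZero d] {k : Fin d}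

theorem planePoint_mem_cng_iff (hk : k ≠ 0) (s t : Fin 4 → F) :
    (fun i => planePoint k (s i) (t i)) ∈ (Cng F d).2 ↔
      (s 0 - s 1) ^ 2 + (t 0 - t 1) ^ 2 = (s 2 - s 3) ^ 2 + (t 2 - t 3) ^ 2 := by
  rw [mem_cng_iff]
  simp [sqEuclDist_eq, planePoint_sub, diagForm_planePoint hk]

theorem planePoint_mem_cngMink_iff (hk : k ≠ 0) (s t : Fin 4 → F) :
    (fun i => planePoint k (s i) (t i)) ∈ (CngMink F d).2 ↔
      (s 0 - s 1) ^ 2 - (t 0 - t 1) ^ 2 = (s 2 - s 3) ^ 2 - (t 2 - t 3) ^ 2 := by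
  rw [mem_cngMink_iff]
  simp [sqMinkDist_eq, planePoint_sub, diagForm_planePoint hk, minkSign, hk,
    ← sub_eq_add_neg]

theorem planePoint_mem_lightlike_iff (hk : k ≠ 0) (s t : Fin 2 → F) :
    (fun i => planePoint k (s i) (t i)) ∈ (Lightlike F d).2 ↔
      (s 0 - s 1) ^ 2 - (t 0 - t 1) ^ 2 = 0 := by
  rw [lightlike_iff]
  simp [planePoint_sub, diagForm_planePoint hk, minkSign, hk, ← sub_eq_add_neg]

theorem planePoint_mem_cngSimul_iff (hk : k ≠ 0) (s t : Fin 4 → F) :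
    (fun i => planePoint k (s i) (t i)) ∈ (CngSimul F d).2 ↔
      (s 0 - s 1) ^ 2 + (t 0 - t 1) ^ 2 = (s 2 - s 3) ^ 2 + (t 2 - t 3) ^ 2 ∧
        s 0 = s 1 ∧ s 2 = s 3 := by
  rw [mem_cngSimul_iff]
  simp [sqEuclDist_eq, planePoint_sub, diagForm_planePoint hk, planePoint_apply_zero hk]

theorem planePoint_mem_simul_iff (hk : k ≠ 0) (s t : Fin 2 → F) :
    (fun i => planePoint k (s i) (t i)) ∈ (Simul F d).2 ↔ s 0 = s 1 := by
  rw [mem_simul_iff]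
  simp [planePoint_apply_zero hk]

theorem planePoint_mem_rest_iff (hk : k ≠ 0) (s t : Fin 2 → F) :
    (fun i => planePoint k (s i) (t i)) ∈ (Rest F d).2 ↔ t 0 = t 1 := by
  rw [mem_rest_iff]
  refine ⟨fun h => by simpa only [planePoint_apply hk] using h k hk, fun h i hi => ?_⟩
  by_cases hik : i = k
  · subst hik
    simpa only [planePoint_apply hk] using h
  · simp only [planePoint_apply_of_ne hi hik]

theorem planePoint_mem_delta_iff (hk : k ≠ 0) (s t : Fin 3 → F) :
    (fun i => planePoint k (s i) (t i)) ∈ (Delta F d).2 ↔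
      s 0 = s 1 ∧ (s 0 - s 2) ^ 2 - (t 0 - t 2) ^ 2 = 0 := by
  rw [mem_delta_iff, lightlike_iff]
  simp [planePoint_sub, planePoint_apply_zero hk, diagForm_planePoint hk, minkSign, hk,
    ← sub_eq_add_neg]

end PlaneRelations

/-! ### Relations that are not concepts -/

section NotConcepts

variable {F : Type*} [Field F] [LinearOrder F] {d : ℕ} [NeZero d] {k : Fin d}

/-- Changing the unit of time and adding a velocity preserves Galilean spacetime. -/
theorem planeMap_mem_iff_of_mem_gal (hk : k ≠ 0) {a c : F} (ha : a ≠ 0) :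
    ∀ R ∈ Gal F d, ∀ x, (fun i => planeMap k a 0 c 1 (x i)) ∈ R.2 ↔ x ∈ R.2 := by
  rintro R (rfl | rfl) x
  · have h0 : ∀ v w : Fin d → F,
        planeMap k a 0 c 1 v 0 = planeMap k a 0 c 1 w 0 ↔ v 0 = w 0 := fun v w => by
      simp [planeMap_apply_zero hk, ha]
    have h1 : ∀ v w : Fin d → F, v 0 = w 0 →
        sqEuclDist (planeMap k a 0 c 1 v) (planeMap k a 0 c 1 w) = sqEuclDist v w :=
      fun v w h => by
        rw [sqEuclDist_eq, ← planeMap_sub, diagForm_planeMap hk, sqEuclDist_eq]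
        simp [h]
    refine (mem_cngSimul_iff _).trans (Iff.trans ?_ (mem_cngSimul_iff _).symm)
    simp only [h0]
    refine and_congr_left fun h => ?_
    rw [h1 _ _ h.1, h1 _ _ h.2]
  · exact planeMap_mem_bw_iff hk (by simpa using ha) x

/-- A pure change of the unit of time also preserves the relation of rest. -/
theorem planeMap_mem_iff_of_mem_newt (hk : k ≠ 0) {a : F} (ha : a ≠ 0) :
    ∀ R ∈ Newt F d, ∀ x, (fun i => planeMap k a 0 0 1 (x i)) ∈ R.2 ↔ x ∈ R.2 := by
  rintro R (rfl | hR) x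
  · refine forall₂_congr fun i hi => ?_
    by_cases hik : i = k
    · subst hik
      simp [planeMap_apply hk]
    · simp only [planeMap_apply_of_ne hi hik]
  · exact planeMap_mem_iff_of_mem_gal hk ha R hR x

variable [IsStrictOrderedRing F]

/-- The rotation by the angle of the right triangle with sides `3, 4, 5` is an automorphism of
Euclidean geometry. -/
theorem planeMap_mem_iff_of_mem_eucl (hk : k ≠ 0) :
    ∀ R ∈ Eucl F d, ∀ x,
      (fun i => planeMap k (3 / 5) (-4 / 5) (4 / 5) (3 / 5) (x i)) ∈ R.2 ↔ x ∈ R.2 := by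
  rintro R (rfl | rfl) x
  · refine (mem_cng_iff _).trans (Iff.trans ?_ (mem_cng_iff _).symm)
    simp only [sqEuclDist_eq, ← planeMap_sub]
    have : ∀ v : Fin d → F, euclForm F d (planeMap k (3 / 5) (-4 / 5) (4 / 5) (3 / 5) v)
        (planeMap k (3 / 5) (-4 / 5) (4 / 5) (3 / 5) v) = euclForm F d v v := fun v => by
      rw [diagForm_planeMap hk]; push_cast; ring
    rw [this, this]
  · exact planeMap_mem_bw_iff hk (by norm_num) x

/-- The Lorentz boost with velocity `3 / 5` is an automorphism of relativistic spacetime. -/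
theorem planeMap_mem_iff_of_mem_relativ (hk : k ≠ 0) :
    ∀ R ∈ Relativ F d, ∀ x,
      (fun i => planeMap k (5 / 4) (3 / 4) (3 / 4) (5 / 4) (x i)) ∈ R.2 ↔ x ∈ R.2 := by
  rintro R (rfl | rfl) x
  · refine (lightlike_iff _).trans (Iff.trans ?_ (lightlike_iff _).symm)
    rw [← planeMap_sub, diagForm_planeMap hk]
    simp only [minkSign, hk, if_true, if_false]
    push_cast
    ring_nf
  · exact planeMap_mem_bw_iff hk (by norm_num) x

theorem notMem_concepts_eucl (hd : 2 ≤ d) :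
    CngMink F d ∉ concepts (Eucl F d) ∧ Lightlike F d ∉ concepts (Eucl F d) ∧
    CngSimul F d ∉ concepts (Eucl F d) ∧ Simul F d ∉ concepts (Eucl F d) ∧
    Rest F d ∉ concepts (Eucl F d) ∧ Delta F d ∉ concepts (Eucl F d) := by
  have : Nontrivial (Fin d) := Fin.nontrivial_iff_two_le.2 hd
  obtain ⟨k, hk⟩ := exists_ne (0 : Fin d)
  have key := @notMem_concepts_of_planeMap F _ d _ k (3 / 5) (-4 / 5) (4 / 5) (3 / 5) _ hk
    (by norm_num) (planeMap_mem_iff_of_mem_eucl hk)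
  refine ⟨key (R := CngMink F d) ![0, 1, 0, 0] ![0, 1, 0, 0] ?_ ?_,
    key (R := Lightlike F d) ![0, 1] ![0, 1] ?_ ?_,
    key (R := CngSimul F d) ![0, 0, 0, 0] ![0, 1, 0, 1] ?_ ?_,
    key (R := Simul F d) ![0, 0] ![0, 1] ?_ ?_, key (R := Rest F d) ![0, 1] ![0, 0] ?_ ?_,
    key (R := Delta F d) ![0, 0, 0] ![0, 1, 0] ?_ ?_⟩
  · refine (planePoint_mem_cngMink_iff hk _ _).2 ?_; simp
  · refine (planePoint_mem_cngMink_iff hk _ _).not.2 ?_; simp; norm_num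
  · refine (planePoint_mem_lightlike_iff hk _ _).2 ?_; simp
  · refine (planePoint_mem_lightlike_iff hk _ _).not.2 ?_; simp; norm_num
  · refine (planePoint_mem_cngSimul_iff hk _ _).2 ?_; simp
  · refine (planePoint_mem_cngSimul_iff hk _ _).not.2 ?_; simp; norm_num
  · refine (planePoint_mem_simul_iff hk _ _).2 ?_; simp
  · refine (planePoint_mem_simul_iff hk _ _).not.2 ?_; simp; norm_num
  · refine (planePoint_mem_rest_iff hk _ _).2 ?_; simp
  · refine (planePoint_mem_rest_iff hk _ _).not.2 ?_; simp; norm_num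
  · refine (planePoint_mem_delta_iff hk _ _).2 ?_; simp
  · refine (planePoint_mem_delta_iff hk _ _).not.2 ?_; simp; norm_num

theorem notMem_concepts_relativ (hd : 2 ≤ d) :
    Cng F d ∉ concepts (Relativ F d) ∧ CngSimul F d ∉ concepts (Relativ F d) ∧
    Simul F d ∉ concepts (Relativ F d) ∧ Rest F d ∉ concepts (Relativ F d) ∧
    Delta F d ∉ concepts (Relativ F d) := by
  have : Nontrivial (Fin d) := Fin.nontrivial_iff_two_le.2 hd
  obtain ⟨k, hk⟩ := exists_ne (0 : Fin d)
  have key := @notMem_concepts_of_planeMap F _ d _ k (5 / 4) (3 / 4) (3 / 4) (5 / 4) _ hk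
    (by norm_num) (planeMap_mem_iff_of_mem_relativ hk)
  refine ⟨key (R := Cng F d) ![0, 1, 0, 1] ![0, 1, 0, -1] ?_ ?_,
    key (R := CngSimul F d) ![0, 0, 0, 0] ![0, 1, 0, 1] ?_ ?_,
    key (R := Simul F d) ![0, 0] ![0, 1] ?_ ?_, key (R := Rest F d) ![0, 1] ![0, 0] ?_ ?_,
    key (R := Delta F d) ![0, 0, 0] ![0, 1, 0] ?_ ?_⟩
  -- the boost stretches one of the two lightlike diagonals and shrinks the other
  · refine (planePoint_mem_cng_iff hk _ _).2 ?_; simp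
  · refine (planePoint_mem_cng_iff hk _ _).not.2 ?_; simp; norm_num
  · refine (planePoint_mem_cngSimul_iff hk _ _).2 ?_; simp
  · refine (planePoint_mem_cngSimul_iff hk _ _).not.2 ?_; simp; norm_num
  · refine (planePoint_mem_simul_iff hk _ _).2 ?_; simp
  · refine (planePoint_mem_simul_iff hk _ _).not.2 ?_; simp; norm_num
  · refine (planePoint_mem_rest_iff hk _ _).2 ?_; simp
  · refine (planePoint_mem_rest_iff hk _ _).not.2 ?_; simp; norm_num
  · refine (planePoint_mem_delta_iff hk _ _).2 ?_; simp
  · refine (planePoint_mem_delta_iff hk _ _).not.2 ?_; simp; norm_num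

theorem rest_notMem_concepts_gal (hd : 2 ≤ d) : Rest F d ∉ concepts (Gal F d) := by
  have : Nontrivial (Fin d) := Fin.nontrivial_iff_two_le.2 hd
  obtain ⟨k, hk⟩ := exists_ne (0 : Fin d)
  refine notMem_concepts_of_planeMap (a := 1) (b := 0) (c := 1) (e := 1) hk (by norm_num)
    (planeMap_mem_iff_of_mem_gal hk one_ne_zero) (R := Rest F d) ![0, 1] ![0, 0] ?_ ?_
  · refine (planePoint_mem_rest_iff hk _ _).2 ?_; simp
  · refine (planePoint_mem_rest_iff hk _ _).not.2 ?_; simp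

theorem notMem_concepts_newt (hd : 2 ≤ d) :
    Cng F d ∉ concepts (Newt F d) ∧ CngMink F d ∉ concepts (Newt F d) ∧
    Lightlike F d ∉ concepts (Newt F d) ∧ Delta F d ∉ concepts (Newt F d) := by
  have : Nontrivial (Fin d) := Fin.nontrivial_iff_two_le.2 hd
  obtain ⟨k, hk⟩ := exists_ne (0 : Fin d)
  have key := @notMem_concepts_of_planeMap F _ d _ k 2 0 0 1 _ hk
    (by norm_num) (planeMap_mem_iff_of_mem_newt hk two_ne_zero)
  refine ⟨key (R := Cng F d) ![0, 1, 0, 0] ![0, 0, 0, 1] ?_ ?_,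
    key (R := CngMink F d) ![0, 1, 0, 0] ![0, 1, 0, 0] ?_ ?_,
    key (R := Lightlike F d) ![0, 1] ![0, 1] ?_ ?_,
    key (R := Delta F d) ![0, 0, 1] ![0, 0, 1] ?_ ?_⟩
  · refine (planePoint_mem_cng_iff hk _ _).2 ?_; simp
  · refine (planePoint_mem_cng_iff hk _ _).not.2 ?_; simp; norm_num
  · refine (planePoint_mem_cngMink_iff hk _ _).2 ?_; simp
  · refine (planePoint_mem_cngMink_iff hk _ _).not.2 ?_; simp; norm_num
  · refine (planePoint_mem_lightlike_iff hk _ _).2 ?_; simp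
  · refine (planePoint_mem_lightlike_iff hk _ _).not.2 ?_; simp; norm_num
  · refine (planePoint_mem_delta_iff hk _ _).2 ?_; simp
  · refine (planePoint_mem_delta_iff hk _ _).not.2 ?_; simp; norm_num

end NotConcepts

/-! ### The hierarchy of the geometries -/

section Hierarchy

variable {F : Type*} [Field F] {d : ℕ} [NeZero d]

theorem lightlike_mem_concepts_mink [LinearOrder F] : Lightlike F d ∈ concepts (Mink F d) := by
  have h : CngMink F d ∈ concepts (Mink F d) := subset_concepts _ (.inl rfl)
  refine mem_concepts_iff.2
    ((DefinablePred.concept h (![0, 1, 0, 0] : Fin 4 → Fin 2)).congr fun x => ?_)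
  refine (lightlike_iff x).trans (Iff.trans ?_ (mem_cngMink_iff _).symm)
  simp only [sqMinkDist_eq, Matrix.cons_val, sub_self, map_zero]

theorem delta_mem_concepts {B : Set (FinRel (Fin d → F))} (hL : Lightlike F d ∈ concepts B)
    (hS : Simul F d ∈ concepts B) : Delta F d ∈ concepts B :=
  mem_concepts_iff.2 (((DefinablePred.concept hS (![0, 1] : Fin 2 → Fin 3)).and
    (DefinablePred.concept hL (![0, 2] : Fin 2 → Fin 3))).congr fun _ => Iff.rfl)

theorem concepts_relativ_eq_concepts_mink [LinearOrder F] [IsStrictOrderedRing F] (hd : 2 ≤ d) :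
    concepts (Relativ F d) = concepts (Mink F d) := by
  refine (concepts_subset_of_subset ?_).antisymm (concepts_subset_of_subset ?_)
  · rintro R (rfl | rfl)
    · exact lightlike_mem_concepts_mink
    · exact subset_concepts _ (.inr rfl)
  · rintro R (rfl | rfl)
    · exact cngMink_mem_concepts hd (subset_concepts _ (.inr rfl)) (subset_concepts _ (.inl rfl))
    · exact subset_concepts _ (.inr rfl)

end Hierarchy

end UnitFreeGeometry

/-! ### The comparison of the geometries -/

theorem mainTheorem2 {F : Type*} [Field F] [LinearOrder F] [IsStrictOrderedRing F]
    (d : ℕ) [NeZero d] (hd : 2 ≤ d) :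
    -- relativistic and Minkowski spacetime are definitionally equivalent
    DefinitionallyEquivalent (Relativ F d) (Mink F d) ∧
    -- the inclusions
    concepts (Gal F d) ⊆ concepts (Newt F d) ∧
    concepts (OAff F d) ⊆ concepts (Eucl F d) ∩ concepts (Relativ F d) ∩ concepts (Gal F d) ∧
    concepts (Eucl F d) ∪ concepts (Relativ F d) ∪ concepts (Newt F d) ⊆ concepts (LClass F d) ∧
    -- the table of concepts; columns: Eucl, Rel, Gal, Newt, LClass
    (Cng F d ∈ concepts (Eucl F d) ∧ Cng F d ∉ concepts (Relativ F d) ∧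
      Cng F d ∉ concepts (Gal F d) ∧ Cng F d ∉ concepts (Newt F d) ∧
      Cng F d ∈ concepts (LClass F d)) ∧
    (CngMink F d ∉ concepts (Eucl F d) ∧ CngMink F d ∈ concepts (Relativ F d) ∧
      CngMink F d ∉ concepts (Gal F d) ∧ CngMink F d ∉ concepts (Newt F d) ∧
      CngMink F d ∈ concepts (LClass F d)) ∧
    (Lightlike F d ∉ concepts (Eucl F d) ∧ Lightlike F d ∈ concepts (Relativ F d) ∧
      Lightlike F d ∉ concepts (Gal F d) ∧ Lightlike F d ∉ concepts (Newt F d) ∧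
      Lightlike F d ∈ concepts (LClass F d)) ∧
    (CngSimul F d ∉ concepts (Eucl F d) ∧ CngSimul F d ∉ concepts (Relativ F d) ∧
      CngSimul F d ∈ concepts (Gal F d) ∧ CngSimul F d ∈ concepts (Newt F d) ∧
      CngSimul F d ∈ concepts (LClass F d)) ∧
    (Simul F d ∉ concepts (Eucl F d) ∧ Simul F d ∉ concepts (Relativ F d) ∧
      Simul F d ∈ concepts (Gal F d) ∧ Simul F d ∈ concepts (Newt F d) ∧
      Simul F d ∈ concepts (LClass F d)) ∧
    (Rest F d ∉ concepts (Eucl F d) ∧ Rest F d ∉ concepts (Relativ F d) ∧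
      Rest F d ∉ concepts (Gal F d) ∧ Rest F d ∈ concepts (Newt F d) ∧
      Rest F d ∈ concepts (LClass F d)) ∧
    (Delta F d ∉ concepts (Eucl F d) ∧ Delta F d ∉ concepts (Relativ F d) ∧
      Delta F d ∉ concepts (Gal F d) ∧ Delta F d ∉ concepts (Newt F d) ∧
      Delta F d ∈ concepts (LClass F d)) ∧
    -- betweenness is a concept of OAff, the other seven relations are not
    Bw F d ∈ concepts (OAff F d) ∧
    (∀ R ∈ ({Cng F d, CngMink F d, Lightlike F d, CngSimul F d, Simul F d, Rest F d, Delta F d} :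
      Set (FinRel (Fin d → F))), R ∉ concepts (OAff F d)) ∧
    -- the inclusions are proper
    (concepts (OAff F d) ⊂ concepts (Eucl F d) ∧ concepts (OAff F d) ⊂ concepts (Relativ F d) ∧
      concepts (OAff F d) ⊂ concepts (Gal F d) ∧ concepts (Gal F d) ⊂ concepts (Newt F d) ∧
      concepts (Eucl F d) ⊂ concepts (LClass F d) ∧ concepts (Relativ F d) ⊂ concepts (LClass F d) ∧
      concepts (Newt F d) ⊂ concepts (LClass F d)) ∧
    -- there are no other inclusions
    (¬ concepts (Eucl F d) ⊆ concepts (Relativ F d) ∧ ¬ concepts (Relativ F d) ⊆ concepts (Eucl F d) ∧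
      ¬ concepts (Eucl F d) ⊆ concepts (Gal F d) ∧ ¬ concepts (Gal F d) ⊆ concepts (Eucl F d) ∧
      ¬ concepts (Eucl F d) ⊆ concepts (Newt F d) ∧ ¬ concepts (Newt F d) ⊆ concepts (Eucl F d) ∧
      ¬ concepts (Relativ F d) ⊆ concepts (Gal F d) ∧ ¬ concepts (Gal F d) ⊆ concepts (Relativ F d) ∧
      ¬ concepts (Relativ F d) ⊆ concepts (Newt F d) ∧
      ¬ concepts (Newt F d) ⊆ concepts (Relativ F d)) := by
  have hBw : ∀ B : Set (FinRel (Fin d → F)), Bw F d ∈ B → Bw F d ∈ concepts B :=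
    fun B h => subset_concepts B h
  have hGN : concepts (Gal F d) ⊆ concepts (Newt F d) := concepts_mono (Set.subset_insert _ _)
  have hOE : concepts (OAff F d) ⊆ concepts (Eucl F d) :=
    concepts_mono (Set.singleton_subset_iff.2 (.inr rfl))
  have hOR : concepts (OAff F d) ⊆ concepts (Relativ F d) :=
    concepts_mono (Set.singleton_subset_iff.2 (.inr rfl))
  have hOG : concepts (OAff F d) ⊆ concepts (Gal F d) :=
    concepts_mono (Set.singleton_subset_iff.2 (.inr rfl))
  -- positive entries of the table
  have cE : Cng F d ∈ concepts (Eucl F d) := subset_concepts _ (.inl rfl)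
  have lR : Lightlike F d ∈ concepts (Relativ F d) := subset_concepts _ (.inl rfl)
  have mR : CngMink F d ∈ concepts (Relativ F d) :=
    cngMink_mem_concepts hd (hBw _ (.inr rfl)) lR
  have sG : CngSimul F d ∈ concepts (Gal F d) := subset_concepts _ (.inl rfl)
  have tG : Simul F d ∈ concepts (Gal F d) := simul_mem_concepts sG
  have rN : Rest F d ∈ concepts (Newt F d) := subset_concepts _ (.inl rfl)
  have bL : Bw F d ∈ concepts (LClass F d) := hBw _ (.inr (.inr rfl))
  have lL : Lightlike F d ∈ concepts (LClass F d) := subset_concepts _ (.inl rfl)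
  have sL : CngSimul F d ∈ concepts (LClass F d) := subset_concepts _ (.inr (.inl rfl))
  have tL : Simul F d ∈ concepts (LClass F d) := simul_mem_concepts sL
  have rL : Rest F d ∈ concepts (LClass F d) := rest_mem_concepts hd bL lL sL
  have cL : Cng F d ∈ concepts (LClass F d) := cng_mem_concepts hd bL lL sL
  have mL : CngMink F d ∈ concepts (LClass F d) := cngMink_mem_concepts hd bL lL
  have dL : Delta F d ∈ concepts (LClass F d) := delta_mem_concepts lL tL
  have hEL : concepts (Eucl F d) ⊆ concepts (LClass F d) := concepts_subset_of_subset (by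
    rintro R (rfl | rfl)
    exacts [cL, bL])
  have hRL : concepts (Relativ F d) ⊆ concepts (LClass F d) := concepts_subset_of_subset (by
    rintro R (rfl | rfl)
    exacts [lL, bL])
  have hNL : concepts (Newt F d) ⊆ concepts (LClass F d) := concepts_subset_of_subset (by
    rintro R (rfl | rfl | rfl)
    exacts [rL, sL, bL])
  -- negative entries of the table
  obtain ⟨mE', lE', sE', tE', rE', dE'⟩ := notMem_concepts_eucl (F := F) hd
  obtain ⟨cR', sR', tR', rR', dR'⟩ := notMem_concepts_relativ (F := F) hd
  obtain ⟨cN', mN', lN', dN'⟩ := notMem_concepts_newt (F := F) hd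
  have rG' : Rest F d ∉ concepts (Gal F d) := rest_notMem_concepts_gal hd
  have hG' : ∀ {R : FinRel (Fin d → F)}, R ∉ concepts (Newt F d) → R ∉ concepts (Gal F d) :=
    fun h h' => h (hGN h')
  -- an inclusion fails as soon as some relation separates the two sets of concepts
  have hns : ∀ {S T : Set (FinRel (Fin d → F))} (R : FinRel (Fin d → F)), R ∈ S → R ∉ T → ¬ S ⊆ T :=
    fun R hS hT h => hT (h hS)
  refine ⟨concepts_relativ_eq_concepts_mink hd, hGN,
    Set.subset_inter (Set.subset_inter hOE hOR) hOG,
    Set.union_subset (Set.union_subset hEL hRL) hNL,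
    ⟨cE, cR', hG' cN', cN', cL⟩, ⟨mE', mR, hG' mN', mN', mL⟩, ⟨lE', lR, hG' lN', lN', lL⟩,
    ⟨sE', sR', sG, hGN sG, sL⟩, ⟨tE', tR', tG, hGN tG, tL⟩, ⟨rE', rR', rG', rN, rL⟩,
    ⟨dE', dR', hG' dN', dN', dL⟩, hBw _ rfl, ?_,
    ⟨⟨hOE, hns _ cE fun h => cR' (hOR h)⟩, ⟨hOR, hns _ lR fun h => lE' (hOE h)⟩,
      ⟨hOG, hns _ sG fun h => sE' (hOE h)⟩, ⟨hGN, hns _ rN rG'⟩, ⟨hEL, hns _ lL lE'⟩,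
      ⟨hRL, hns _ cL cR'⟩, ⟨hNL, hns _ cL cN'⟩⟩,
    hns _ cE cR', hns _ lR lE', hns _ cE (hG' cN'), hns _ sG sE', hns _ cE cN',
    hns _ (hGN sG) sE', hns _ lR (hG' lN'), hns _ sG sR', hns _ lR lN', hns _ (hGN sG) sR'⟩
  rintro R (rfl | rfl | rfl | rfl | rfl | rfl | rfl) h
  exacts [cR' (hOR h), mE' (hOE h), lE' (hOE h), sE' (hOE h), tE' (hOE h), rE' (hOE h),
    dE' (hOE h)]
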